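/- Identify $2^\omega$ with the functions $\omega\to\{0,1\}$, with coordinatewise addition modulo $2$, and let $\mathbb Q=\{x\in 2^\omega: x(n)=0\text{ for all but finitely many }n\}$. Say that $g\in\omega^\omega$ *witnesses that $X\subseteq 2^\omega$ does not have strong measure zero* if there is no sequence $f$ with $f(m)\in 2^{g(m)}$ for all $m$ such that every $x\in X$ satisfies $x\restriction g(m)=f(m)$ for infinitely many $m$. Fix reals $\varepsilon^k_j$ ($j\le k<\omega$) such that for every $k$: $0<\varepsilon^k_0<\varepsilon^k_1<\dots<\varepsilon^k_k\le 2^{-k}$, and for every $j<k$: $(\varepsilon^k_{j+1})^3>\varepsilon^k_j$, $\varepsilon^k_{j+1}/2^{k^2}>\varepsilon^k_j$ and $\varepsilon^k_j/\varepsilon^k_{j+1}<\varepsilon^k_k$. Let $g\in\omega^\omega$ be strictly increasing and let $\langle n_k:k\in\omega\rangle$ be a strictly increasing sequence of natural numbers with $n_0=0$ and $$n_{k+1}\ \ge\ g\left(\left\lfloor (k+1)\,2^{n_k}\,\frac{2^{n_k2^{n_k}}}{\varepsilon^k_0}\right\rfloor\right)\qquad(k\in\omega).$$ Let $F_k$ be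 the set of all functions from $2^{[n_k,n_{k+1})}$ to $\{0,1\}$. For $A\subseteq F_k$ let $\|A\|$ be the largest $\ell\le k$ with $|A|/|F_k|\ge\varepsilon^k_\ell$ (and $0$ if there is none). Let $T^{max}$ be the tree of all finite sequences $s$ with $s(j)\in F_j$ for all $j<|s|$, and let $\mathbb P_g$ be the set of all perfect subtrees $T\subseteq T^{max}$ such that $$\lim_{k\to\infty}\min\{\|\mathrm{succ}_T(s)\|: s\in T,\ |s|=k\}=\infty,$$ where $\mathrm{succ}_T(s)=\{f\in F_{|s|}: s^\frown f\in T\}$; a condition is stronger if it is a smaller tree. If $G\subseteq\mathbb P_g$ is generic over the ground model $\mathbf V$, let $\langle f_0,f_1,\dots\rangle$ be the branch $\bigcap G$, and define in $\mathbf V[G]$ the map $F_G:2^\omega\to2^\omega$ by $$F_G(x)(k)=f_k\big(x\restriction[n_k,n_{k+1})\big),$$ and, for $q\in\mathbb Q$, the map $F_q(x)=F_G(x)+q$. **Theorem.** Suppose that in $\mathbf V$ the function $g$ witnesses that $X\subseteq2^\omega$, $X\in\mathbf V$, does not have strong measure zero. Then $\mathbb P_g$ forces that $F_G$ is continuous and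 that $$F_G''(X)+\mathbb Q=2^\omega .$$ Consequently, $\mathbb P_g$ forces that for every proper $\sigma$-ideal $\mathcal J$ of subsets of $2^\omega$ there is $q\in\mathbb Q$ with $F_q''(X)\notin\mathcal J$. -/

import Mathlib

open Filter

/-! ### Forcing over the ground model

The ground model is the ambient universe.  A notion of forcing is a preorder `P`, where `p ≤ q` means
that `p` is a stronger condition than `q`.  A statement of the forcing language is given by the set of
conditions which force it, and the usual clauses of the definition of the forcing relation compute this
set for compound statements. -/

namespace Forcing

/-- Statements of the forcing language: `φ p` means that `p` forces `φ`. -/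
abbrev Sentence (P : Type) : Type := P → Prop

section Connectives

variable {P : Type} [Preorder P]

/-- A statement about ground model objects whose truth value does not depend on the generic filter. -/
def const (c : Prop) : Sentence P := fun _ => c

def and (φ ψ : Sentence P) : Sentence P := fun p => φ p ∧ ψ p

def neg (φ : Sentence P) : Sentence P := fun p => ∀ q ≤ p, ¬ φ q

def imp (φ ψ : Sentence P) : Sentence P := fun p => ∀ q ≤ p, φ q → ψ q

def iff (φ ψ : Sentence P) : Sentence P := and (imp φ ψ) (imp ψ φ)

/-- Universal quantification, over all names of some kind or over all elements of a ground model set. -/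
def all {I : Type} (φ : I → Sentence P) : Sentence P := fun p => ∀ i, φ i p

/-- Existential quantification: the conditions which force some instance are dense below `p`. -/
def ex {I : Type} (φ : I → Sentence P) : Sentence P := fun p => ∀ q ≤ p, ∃ r ≤ q, ∃ i, φ i r

/-- `⊩ φ`: every condition forces `φ`. -/
def Forced (φ : Sentence P) : Prop := ∀ p, φ p

end Connectives

/-! ### Names

As usual, a name is a set of pairs consisting of a name and a condition.  Names for subsets of a ground
model set `A` are sets of pairs `(a, p)` with `a ∈ A` (standing for `ǎ`).  Every element of `2^ω`, every
subset of `2^ω`, and every family of subsets of `2^ω` in the extension has a name of the kind below. -/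

/-- Names for subsets of the ground model set `A`. -/
abbrev SubName (P A : Type) : Type := Set (A × P)

/-- Names for elements `x` of `2^ω`; `x` is identified with the subset `{n | x n = 1}` of `ω`. -/
abbrev RealName (P : Type) : Type := SubName P ℕ

/-- Names for subsets of `2^ω`. -/
abbrev SetName (P : Type) : Type := Set (RealName P × P)

/-- Names for families of subsets of `2^ω`. -/
abbrev FamName (P : Type) : Type := Set (SetName P × P)

section Names

variable {P : Type} [Preorder P]

/-- `ǎ ∈ σ`. -/
def SubName.mem {A : Type} (a : A) (σ : SubName P A) : Sentence P :=
  fun p => ∀ q ≤ p, ∃ r ≤ q, ∃ s, (a, s) ∈ σ ∧ r ≤ s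

/-- The name of the generic filter, `{(p̌, p) : p ∈ P}`. -/
def generic (P : Type) : SubName P P := {x | x.1 = x.2}

/-- `x(n) = b`, where a bit `b` is a Boolean (`true` is `1`, `false` is `0`). -/
def RealName.bit (x : RealName P) (n : ℕ) (b : Bool) : Sentence P :=
  if b = true then SubName.mem n x else neg (SubName.mem n x)

/-- `x = y`, for `x, y ∈ 2^ω`. -/
def RealName.eq (x y : RealName P) : Sentence P :=
  all fun n : ℕ => iff (SubName.mem n x) (SubName.mem n y)

/-- `x ↾ m = y ↾ m`. -/
def RealName.agree (m : ℕ) (x y : RealName P) : Sentence P :=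
  all fun i : Fin m => iff (SubName.mem (i : ℕ) x) (SubName.mem (i : ℕ) y)

/-- The name for the `x ∈ 2^ω` such that `x(n) = 1` if and only if `φ n`. -/
def RealName.ofSentence (φ : ℕ → Sentence P) : RealName P := {x | φ x.1 x.2}

/-- The canonical name `x̌` of a ground model real. -/
def RealName.check (P : Type) (x : ℕ → Bool) : RealName P := {y | x y.1 = true}

/-- The name of `x + y`, where addition in `2^ω` is coordinatewise modulo `2`. -/
def RealName.add (x y : RealName P) : RealName P :=
  RealName.ofSentence fun n => neg (iff (SubName.mem n x) (SubName.mem n y))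

/-- `x ∈ A`, for `x ∈ 2^ω` and `A ⊆ 2^ω`. -/
def SetName.mem (x : RealName P) (A : SetName P) : Sentence P :=
  fun p => ∀ q ≤ p, ∃ r ≤ q, ∃ y s, (y, s) ∈ A ∧ r ≤ s ∧ RealName.eq x y r

/-- `A ⊆ B`. -/
def SetName.subset (A B : SetName P) : Sentence P :=
  all fun x : RealName P => imp (SetName.mem x A) (SetName.mem x B)

/-- `A = B`. -/
def SetName.eq (A B : SetName P) : Sentence P :=
  and (SetName.subset A B) (SetName.subset B A)

/-- The name of `{x ∈ 2^ω : φ x}`. -/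
def SetName.ofSentence (φ : RealName P → Sentence P) : SetName P := {x | φ x.1 x.2}

/-- The canonical name `X̌` of a ground model set of reals. -/
def SetName.check (P : Type) (X : Set (ℕ → Bool)) : SetName P :=
  {y | ∃ x ∈ X, y.1 = RealName.check P x}

/-- The name of the set `2^ω` of the extension. -/
def SetName.univ (P : Type) : SetName P := Set.univ

/-- The name of the union of a sequence of sets. -/
def SetName.iUnion (A : ℕ → SetName P) : SetName P := ⋃ n, A n

/-- The name of the image `F"(A)`, for a map `F` of `2^ω` given by an operation on names. -/
def SetName.image (F : RealName P → RealName P) (A : SetName P) : SetName P :=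
  {y | ∃ x, (x, y.2) ∈ A ∧ y.1 = F x}

/-- The name of `A + B = {a + b : a ∈ A, b ∈ B}`. -/
def SetName.add (A B : SetName P) : SetName P :=
  SetName.ofSentence fun z => ex fun a : RealName P => ex fun b : RealName P =>
    and (SetName.mem a A) (and (SetName.mem b B) (RealName.eq z (RealName.add a b)))

/-- The name of the set `ℚ = {x ∈ 2^ω : x(n) = 0 for all but finitely many n}` of rationals. -/
def rationals (P : Type) [Preorder P] : SetName P :=
  SetName.ofSentence fun x => ex fun m : ℕ => all fun n : ℕ =>
    imp (const (m ≤ n)) (RealName.bit x n false)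

/-- `A ∈ J`, for `A ⊆ 2^ω` and a family `J` of subsets of `2^ω`. -/
def FamName.mem (A : SetName P) (J : FamName P) : Sentence P :=
  fun p => ∀ q ≤ p, ∃ r ≤ q, ∃ B s, (B, s) ∈ J ∧ r ≤ s ∧ SetName.eq A B r

/-- `J` is a (proper) σ-ideal of subsets of `2^ω`.  Every `ω`-sequence of subsets of `2^ω` in the extension
is the sequence of the values of a ground model sequence of names. -/
def FamName.isSigmaIdeal (J : FamName P) : Sentence P :=
  and (FamName.mem ∅ J) <|
  and (all fun A : SetName P => all fun B : SetName P =>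
    imp (SetName.subset B A) (imp (FamName.mem A J) (FamName.mem B J))) <|
  and (all fun A : ℕ → SetName P =>
    imp (all fun n : ℕ => FamName.mem (A n) J) (FamName.mem (SetName.iUnion A) J))
  (neg (FamName.mem (SetName.univ P) J))

/-- The map `F : 2^ω → 2^ω` is continuous. -/
def isContinuous (F : RealName P → RealName P) : Sentence P :=
  all fun x : RealName P => all fun m : ℕ => ex fun N : ℕ => all fun y : RealName P =>
    imp (RealName.agree N x y) (RealName.agree m (F x) (F y))

end Names

end Forcing

/-! ### Strong measure zero -/

/-- `g` witnesses that `X ⊆ 2^ω` does not have strong measure zero: there is no sequence `f` with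
`f m ∈ 2^{g m}` such that every `x ∈ X` satisfies `x ↾ g m = f m` for infinitely many `m`. -/
def WitnessesNotSMZ (g : ℕ → ℕ) (X : Set (ℕ → Bool)) : Prop :=
  ¬ ∃ f : (m : ℕ) → (Fin (g m) → Bool),
    ∀ x ∈ X, ∃ᶠ m in atTop, (fun i : Fin (g m) => x i) = f m

/-! ### The forcing notion `ℙ_g` -/

namespace PgForcing

/-- The requirements on the numbers `ε^k_j`, `j ≤ k` (written `ε k j`). -/
structure IsEpsSeq (ε : ℕ → ℕ → ℝ) : Prop where
  pos : ∀ k, 0 < ε k 0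
  lt_succ : ∀ k, ∀ j < k, ε k j < ε k (j + 1)
  top_le : ∀ k, ε k k ≤ 1 / 2 ^ k
  lt_cube : ∀ k, ∀ j < k, ε k j < ε k (j + 1) ^ 3
  lt_div : ∀ k, ∀ j < k, ε k j < ε k (j + 1) / 2 ^ (k ^ 2)
  ratio_lt : ∀ k, ∀ j < k, ε k j / ε k (j + 1) < ε k k

/-- The requirements on the sequence `n_k` (written `n k`). -/
structure IsBlockSeq (g : ℕ → ℕ) (ε : ℕ → ℕ → ℝ) (n : ℕ → ℕ) : Prop where
  zero : n 0 = 0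
  strictMono : StrictMono n
  large : ∀ k : ℕ, g ⌊((k : ℝ) + 1) * 2 ^ n k * (2 ^ (n k * 2 ^ n k) / ε k 0)⌋₊ ≤ n (k + 1)

/-- The set `2^{[n_k, n_{k+1})}`. -/
abbrev Block (n : ℕ → ℕ) (k : ℕ) : Type := Set.Ico (n k) (n (k + 1)) → Bool

/-- The set `F_k` of all functions from `2^{[n_k, n_{k+1})}` to `{0, 1}`. -/
abbrev Fn (n : ℕ → ℕ) (k : ℕ) : Type := Block n k → Bool

/-- The set `∏_{j < k} F_j`, the `k`-th level of `T^max`. -/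
abbrev Node (n : ℕ → ℕ) (k : ℕ) : Type := (j : Fin k) → Fn n j

/-- `s ↾ k`, for a sequence `s` of length `m ≥ k`. -/
def Node.restrict {n : ℕ → ℕ} {k m : ℕ} (h : k ≤ m) (s : Node n m) : Node n k :=
  fun j => s (Fin.castLE h j)

/-- `s⌢f`. -/
def Node.append {n : ℕ → ℕ} {k : ℕ} (s : Node n k) (f : Fn n k) : Node n (k + 1) :=
  Fin.snoc (α := fun j : Fin (k + 1) => Fn n j) s f

/-- The set of immediate successors of `s` in a tree `T` given by its levels. -/
def succs {n : ℕ → ℕ} (T : (k : ℕ) → Set (Node n k)) {k : ℕ} (s : Node n k) : Set (Fn n k) :=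
  {f | s.append f ∈ T (k + 1)}

/-- The norm of `A ⊆ F_k`: the largest `ℓ ≤ k` with `|A| / |F_k| ≥ ε^k_ℓ` (and `0` if there is none). -/
noncomputable def nor (ε : ℕ → ℕ → ℝ) {n : ℕ → ℕ} {k : ℕ} (A : Set (Fn n k)) : ℕ :=
  sSup {l : ℕ | l ≤ k ∧ ε k l ≤ (A.ncard : ℝ) / Nat.card (Fn n k)}

/-- The conditions of `ℙ_g`: perfect subtrees `T` of `T^max` for which the minimum of the norms of the
sets of successors of the nodes of length `k` tends to infinity with `k`. -/
structure Cond (ε : ℕ → ℕ → ℝ) (n : ℕ → ℕ) where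
  /-- `level k` is the set of the elements of the tree of length `k`. -/
  level : (k : ℕ) → Set (Node n k)
  restrict_mem : ∀ {k m : ℕ} (h : k ≤ m) (s : Node n m), s ∈ level m → s.restrict h ∈ level k
  nonempty : (level 0).Nonempty
  perfect : ∀ (k : ℕ), ∀ s ∈ level k, ∃ (m : ℕ) (h : k ≤ m), ∃ t ∈ level m,
    t.restrict h = s ∧ (succs level t).Nontrivial
  norm_tendsto : ∀ M : ℕ, ∀ᶠ k in atTop, ∀ s ∈ level k, M ≤ nor ε (succs level s)

/-- A condition is stronger if it is a smaller tree. -/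
instance (ε : ℕ → ℕ → ℝ) (n : ℕ → ℕ) : Preorder (Cond ε n) where
  le T S := ∀ k, T.level k ⊆ S.level k
  le_refl _ _ := subset_rfl
  le_trans _ _ _ h₁ h₂ k := (h₁ k).trans (h₂ k)

open Forcing

variable {ε : ℕ → ℕ → ℝ} {n : ℕ → ℕ}

/-- `s ∈ ⋂ G`, that is, the sequence `s` belongs to every tree in the generic filter. -/
def inGenericBranch {k : ℕ} (s : Node n k) : Sentence (Cond ε n) :=
  all fun T : Cond ε n => imp (SubName.mem T (generic (Cond ε n))) (const (s ∈ T.level k))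

/-- `f_k = f`, where `⟨f_0, f_1, …⟩` is the generic branch `⋂ G`. -/
def genericFnEq (k : ℕ) (f : Fn n k) : Sentence (Cond ε n) :=
  ex fun s : Node n (k + 1) => and (inGenericBranch s) (const (s (Fin.last k) = f))

/-- `x ↾ [n_k, n_{k+1}) = u`. -/
def blockEq (x : RealName (Cond ε n)) (k : ℕ) (u : Block n k) : Sentence (Cond ε n) :=
  all fun i : Set.Ico (n k) (n (k + 1)) => RealName.bit x i (u i)

/-- The generic map `F_G : 2^ω → 2^ω`, `F_G(x)(k) = f_k (x ↾ [n_k, n_{k+1}))`. -/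
def genericMap (x : RealName (Cond ε n)) : RealName (Cond ε n) :=
  RealName.ofSentence fun k => ex fun u : Block n k => ex fun f : Fn n k =>
    and (blockEq x k u) (and (genericFnEq k f) (const (f u = true)))

/-- The translate `F_q(x) = F_G(x) + q`. -/
def genericTranslate (q x : RealName (Cond ε n)) : RealName (Cond ε n) :=
  RealName.add (genericMap x) q

end PgForcing

/-!
A condition forces `z = F_q(x)` for some `x ∈ X` and some rational `q` as soon as it forces
`f_k (x ↾ [n_k, n_{k+1})) = z(k)` for almost all `k`.  The proof shows that such conditions, with `x ∈ X`,
are dense for every name `z` of a real (`exists_eq_genericTranslate`).  This gives `F_G''(X) + ℚ = 2^ω`;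
and if `F_q''(X)` were in a σ-ideal for each of the countably many `q`, then so would be their union
`2^ω`.  Continuity is plain, as `F_G(x) ↾ m` depends on `x ↾ n_m` only.

The density is proved in three steps.

* *Continuous reading of names* (`exists_continuous_reading`).  A fusion yields a tree `T` below a given
  condition such that each `z(i)` is decided by the nodes of some length `N i`.  The fusion rests on pure
  decision (`exists_good`): call a node good if some subtree above it, with the same stem and norms at
  least `h`, decides `z(i)`.  The nodes which are not good would form a condition, but any decision below
  this condition makes its nodes far up good.
* *Early reading* (`exists_early_reading`).  One can have `N k = k` for almost all `k`.  Since splitting a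
  set of successors into `2^(k^2)` pieces costs only one unit of the norm, the values `z(0), …, z(k)` can
  be predicted at a node of length `k` by backward induction from any later level.  Predictions which
  work for every lookahead exist by König's lemma, and they define the subtree.
* *Choice of `x`* (`exists_eventually_bit_eq`).  For a node `t` of length `k`, all but at most `1 / ε^k_0`
  points `u` of the block are such that both `{f ∈ succ(t) : f(u) = 0}` and `{f ∈ succ(t) : f(u) = 1}`
  have nearly the norm of `succ(t)` (`ncard_badSet_le`).  The growth of `n_k` leaves room to list all bad
  initial segments along a single sequence `f` with `f m ∈ 2^{g m}`, so some `x ∈ X` has only finitely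
  many of them (`exists_eventually_not_mem`).  For this `x` the tree can be thinned out to the successors
  `f` with `f (x ↾ [n_k, n_{k+1})) = z(k)`.
-/

/-! ### Regular sentences and bits of names -/

namespace Forcing

variable {P : Type} [Preorder P]

/-- A sentence is regular if the set of conditions forcing it is downward closed and contains every
condition below which it is dense, as is the case for every statement of the forcing language. -/
structure IsRegular (φ : Sentence P) : Prop where
  mono : ∀ {p q : P}, q ≤ p → φ p → φ q
  of_dense : ∀ {p : P}, (∀ q ≤ p, ∃ r ≤ q, φ r) → φ p

theorem IsRegular.and {φ ψ : Sentence P} (hφ : IsRegular φ) (hψ : IsRegular ψ) :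
    IsRegular (and φ ψ) where
  mono h h' := ⟨hφ.mono h h'.1, hψ.mono h h'.2⟩
  of_dense h := ⟨hφ.of_dense fun q hq => let ⟨r, hr, h'⟩ := h q hq; ⟨r, hr, h'.1⟩,
    hψ.of_dense fun q hq => let ⟨r, hr, h'⟩ := h q hq; ⟨r, hr, h'.2⟩⟩

theorem IsRegular.neg {φ : Sentence P} (hφ : IsRegular φ) : IsRegular (neg φ) where
  mono h h' q hq := h' q (hq.trans h)
  of_dense h _ hq hφq := let ⟨r, hr, h'⟩ := h _ hq; h' r le_rfl (hφ.mono hr hφq)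

theorem IsRegular.imp {φ ψ : Sentence P} (hφ : IsRegular φ) (hψ : IsRegular ψ) :
    IsRegular (imp φ ψ) where
  mono h h' q hq := h' q (hq.trans h)
  of_dense h _ hq hφq := hψ.of_dense fun q' hq' =>
    let ⟨r, hr, h'⟩ := h q' (hq'.trans hq)
    ⟨r, hr, h' r le_rfl (hφ.mono (hr.trans hq') hφq)⟩

theorem IsRegular.iff {φ ψ : Sentence P} (hφ : IsRegular φ) (hψ : IsRegular ψ) :
    IsRegular (iff φ ψ) :=
  (hφ.imp hψ).and (hψ.imp hφ)

theorem IsRegular.all {I : Type} {φ : I → Sentence P} (hφ : ∀ i, IsRegular (φ i)) :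
    IsRegular (all φ) where
  mono h h' i := (hφ i).mono h (h' i)
  of_dense h i := (hφ i).of_dense fun q hq => let ⟨r, hr, h'⟩ := h q hq; ⟨r, hr, h' i⟩

theorem IsRegular.ex {I : Type} (φ : I → Sentence P) : IsRegular (ex φ) where
  mono h h' q hq := h' q (hq.trans h)
  of_dense h q hq :=
    let ⟨r, hr, h'⟩ := h q hq
    let ⟨s, hs, h''⟩ := h' r le_rfl
    ⟨s, hs.trans hr, h''⟩

/-- Membership in a name is a sentence of this shape: `ψ` holds densely below the condition. -/
theorem IsRegular.dense (ψ : P → Prop) : IsRegular (fun p => ∀ q ≤ p, ∃ r ≤ q, ψ r) where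
  mono h h' q hq := h' q (hq.trans h)
  of_dense h q hq :=
    let ⟨r, hr, h'⟩ := h q hq
    let ⟨s, hs, h''⟩ := h' r le_rfl
    ⟨s, hs.trans hr, h''⟩

theorem SubName.mem_isRegular {A : Type} (a : A) (σ : SubName P A) : IsRegular (SubName.mem a σ) :=
  IsRegular.dense _

theorem FamName.mem_isRegular (A : SetName P) (J : FamName P) : IsRegular (FamName.mem A J) :=
  IsRegular.dense _

theorem RealName.bit_isRegular (x : RealName P) (n : ℕ) (b : Bool) :
    IsRegular (RealName.bit x n b) := by
  cases b
  · simpa [RealName.bit] using (SubName.mem_isRegular n x).neg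
  · simpa [RealName.bit] using SubName.mem_isRegular n x

theorem RealName.eq_isRegular (x y : RealName P) : IsRegular (RealName.eq x y) :=
  .all fun n => (SubName.mem_isRegular n x).iff (SubName.mem_isRegular n y)

theorem RealName.bit_true {x : RealName P} {n : ℕ} {p : P} :
    RealName.bit x n true p ↔ SubName.mem n x p := by simp [RealName.bit]

theorem RealName.bit_false {x : RealName P} {n : ℕ} {p : P} :
    RealName.bit x n false p ↔ neg (SubName.mem n x) p := by simp [RealName.bit]

theorem RealName.exists_bit (x : RealName P) (n : ℕ) (p : P) :
    ∃ q ≤ p, ∃ b, RealName.bit x n b q := by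
  by_cases h : ∃ q ≤ p, SubName.mem n x q
  · obtain ⟨q, hq, h⟩ := h
    exact ⟨q, hq, true, RealName.bit_true.2 h⟩
  · push Not at h
    exact ⟨p, le_rfl, false, RealName.bit_false.2 h⟩

theorem RealName.bit_unique {x : RealName P} {n : ℕ} {b c : Bool} {p : P}
    (hb : RealName.bit x n b p) (hc : RealName.bit x n c p) : b = c := by
  cases b <;> cases c <;> simp only [RealName.bit_true, RealName.bit_false] at hb hc ⊢
  · exact absurd hc (hb p le_rfl)
  · exact absurd hb (hc p le_rfl)

theorem RealName.bit_of_iff {x y : RealName P} {n : ℕ} {b : Bool} {p : P}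
    (h : iff (SubName.mem n x) (SubName.mem n y) p) (hx : RealName.bit x n b p) :
    RealName.bit y n b p := by
  cases b
  · exact RealName.bit_false.2 fun q hq hy => RealName.bit_false.1 hx q hq (h.2 q hq hy)
  · exact RealName.bit_true.2 (h.1 p le_rfl (RealName.bit_true.1 hx))

/-- Two names have the same value at `n` as soon as every decision about the first is a decision
about the second: the decisions are dense. -/
theorem RealName.iff_of_bit {x y : RealName P} {n : ℕ} {p : P}
    (h : ∀ q ≤ p, ∀ b, RealName.bit x n b q → RealName.bit y n b q) :
    iff (SubName.mem n x) (SubName.mem n y) p := by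
  refine ⟨fun q hq hx => RealName.bit_true.1 (h q hq true (RealName.bit_true.2 hx)),
    fun q hq hy => (SubName.mem_isRegular n x).of_dense fun q' hq' => ?_⟩
  obtain ⟨r, hr, b, hb⟩ := RealName.exists_bit x n q'
  cases b
  · have := RealName.bit_false.1 (h r (hr.trans (hq'.trans hq)) _ hb) r le_rfl
    exact absurd ((SubName.mem_isRegular n y).mono (hr.trans hq') hy) this
  · exact ⟨r, hr, RealName.bit_true.1 hb⟩

theorem RealName.eq_refl (x : RealName P) (p : P) : RealName.eq x x p :=
  fun _ => ⟨fun _ _ h => h, fun _ _ h => h⟩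

theorem RealName.mem_ofSentence {φ : ℕ → Sentence P} {n : ℕ} (hφ : IsRegular (φ n)) {p : P} :
    SubName.mem n (RealName.ofSentence φ) p ↔ φ n p := by
  constructor
  · intro h
    refine hφ.of_dense fun q hq => ?_
    obtain ⟨r, hr, s, hs, hrs⟩ := h q hq
    exact ⟨r, hr, hφ.mono hrs hs⟩
  · intro h q hq
    exact ⟨q, le_rfl, p, h, hq⟩

theorem RealName.bit_check (x : ℕ → Bool) (n : ℕ) (p : P) :
    RealName.bit (RealName.check P x) n (x n) p := by
  cases h : x n
  · refine RealName.bit_false.2 fun q _ hq => ?_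
    obtain ⟨r, _, s, hs, _⟩ := hq q le_rfl
    exact Bool.false_ne_true (h.symm.trans hs)
  · exact RealName.bit_true.2 fun q _ => ⟨q, le_rfl, q, h, le_rfl⟩

theorem RealName.mem_add {x y : RealName P} {n : ℕ} {p : P} :
    SubName.mem n (RealName.add x y) p ↔ neg (iff (SubName.mem n x) (SubName.mem n y)) p :=
  RealName.mem_ofSentence (φ := fun n => neg (iff (SubName.mem n x) (SubName.mem n y)))
    ((SubName.mem_isRegular n x).iff (SubName.mem_isRegular n y)).neg

theorem RealName.bit_add {x y : RealName P} {n : ℕ} {b c : Bool} {p : P}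
    (hx : RealName.bit x n b p) (hy : RealName.bit y n c p) :
    RealName.bit (RealName.add x y) n (b ^^ c) p := by
  have key : ∀ q ≤ p, iff (SubName.mem n x) (SubName.mem n y) q → b = c := fun q hq h =>
    RealName.bit_unique (RealName.bit_of_iff h ((RealName.bit_isRegular x n b).mono hq hx))
      ((RealName.bit_isRegular y n c).mono hq hy)
  by_cases hbc : b = c
  · subst hbc
    rw [Bool.xor_self, RealName.bit_false]
    refine fun q hq h => RealName.mem_add.1 h q le_rfl (RealName.iff_of_bit fun r hr b' hb' => ?_)
    rw [RealName.bit_unique hb' ((RealName.bit_isRegular x n b).mono (hr.trans hq) hx)]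
    exact (RealName.bit_isRegular y n b).mono (hr.trans hq) hy
  · have : (b ^^ c) = true := by cases b <;> cases c <;> simp_all
    rw [this, RealName.bit_true, RealName.mem_add]
    exact fun q hq h => hbc (key q hq h)

/-- Finitely many bits can be decided simultaneously. -/
theorem RealName.exists_bits (x : RealName P) (m : ℕ) (p : P) :
    ∃ q ≤ p, ∃ b : ℕ → Bool, ∀ n < m, RealName.bit x n (b n) q := by
  induction m with
  | zero => exact ⟨p, le_rfl, fun _ => false, fun n hn => absurd hn (Nat.not_lt_zero n)⟩
  | succ m ih =>
    obtain ⟨q, hq, b, hb⟩ := ih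
    obtain ⟨r, hr, c, hc⟩ := RealName.exists_bit x m q
    refine ⟨r, hr.trans hq, Function.update b m c, fun n hn => ?_⟩
    rcases Nat.lt_succ_iff_lt_or_eq.1 hn with h | rfl
    · rw [Function.update_of_ne h.ne]
      exact (RealName.bit_isRegular x n _).mono hr (hb n h)
    · rwa [Function.update_self]

end Forcing

/-! ### Nodes and restrictions of conditions -/

namespace PgForcing

variable {ε : ℕ → ℕ → ℝ} {n : ℕ → ℕ}

/-- The node `s` without its last entry. -/
def Node.init {k : ℕ} (s : Node n (k + 1)) : Node n k := s.restrict (Nat.le_succ k)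

@[simp] theorem Node.init_append {k : ℕ} (s : Node n k) (f : Fn n k) : (s.append f).init = s := by
  funext j
  exact Fin.snoc_castSucc (α := fun j : Fin (k + 1) => Fn n j) f s j

@[simp] theorem Node.append_last {k : ℕ} (s : Node n k) (f : Fn n k) :
    s.append f (Fin.last k) = f :=
  Fin.snoc_last (α := fun j : Fin (k + 1) => Fn n j) f s

@[simp] theorem Node.init_append_last {k : ℕ} (s : Node n (k + 1)) :
    s.init.append (s (Fin.last k)) = s :=
  Fin.snoc_init_self (α := fun j : Fin (k + 1) => Fn n j) s

theorem Node.restrict_append {k l : ℕ} (h : l ≤ k) (s : Node n k) (f : Fn n k) :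
    (s.append f).restrict (h.trans (Nat.le_succ k)) = s.restrict h := by
  conv_rhs => rw [← Node.init_append s f]
  rfl

/-- Two nodes are compatible if one of them extends the other. -/
def Node.Compat {k m : ℕ} (s : Node n m) (t : Node n k) : Prop :=
  ∀ (j : ℕ) (h : j < k) (h' : j < m), t ⟨j, h⟩ = s ⟨j, h'⟩

theorem Node.compat_iff_of_le {k m : ℕ} (h : m ≤ k) {s : Node n m} {t : Node n k} :
    s.Compat t ↔ t.restrict h = s :=
  ⟨fun H => funext fun j => H j (j.2.trans_le h) j.2, fun H j _ h' => by rw [← H]; rfl⟩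

theorem Node.compat_iff_of_ge {k m : ℕ} (h : k ≤ m) {s : Node n m} {t : Node n k} :
    s.Compat t ↔ t = s.restrict h :=
  ⟨fun H => funext fun j => H j j.2 (j.2.trans_le h), fun H j _ h' => by rw [H]; rfl⟩

theorem Node.Compat.restrict {k l m : ℕ} {s : Node n m} {t : Node n k} (h : l ≤ k)
    (H : s.Compat t) : s.Compat (t.restrict h) :=
  fun j hj h' => H j (hj.trans_le h) h'

theorem Node.Compat.append {k m : ℕ} {s : Node n m} {t : Node n k} (h : m ≤ k)
    (H : s.Compat t) (f : Fn n k) : s.Compat (t.append f) :=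
  (Node.compat_iff_of_le (h.trans (Nat.le_succ k))).2
    ((Node.restrict_append h t f).trans ((Node.compat_iff_of_le h).1 H))

namespace Cond

variable {T S : Cond ε n}

theorem mem_init {k : ℕ} {s : Node n (k + 1)} (hs : s ∈ T.level (k + 1)) : s.init ∈ T.level k :=
  T.restrict_mem _ s hs

theorem last_mem_succs {k : ℕ} {s : Node n (k + 1)} (hs : s ∈ T.level (k + 1)) :
    s (Fin.last k) ∈ succs T.level s.init := by
  simpa [succs] using hs

theorem succs_mono (h : T ≤ S) {k : ℕ} (s : Node n k) : succs T.level s ⊆ succs S.level s :=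
  fun _ hf => h _ hf

theorem succs_nonempty {k : ℕ} {s : Node n k} (hs : s ∈ T.level k) :
    (succs T.level s).Nonempty := by
  obtain ⟨m, hkm, t, ht, rfl, hn⟩ := T.perfect k s hs
  obtain ⟨f, hf⟩ := hn.nonempty
  have h1 : k + 1 ≤ m + 1 := Nat.succ_le_succ hkm
  have h2 := T.restrict_mem h1 _ hf
  refine ⟨(t.append f).restrict h1 (Fin.last k), ?_⟩
  have := last_mem_succs h2
  have h3 : ((t.append f).restrict h1).init = t.restrict hkm := Node.restrict_append hkm t f
  rw [h3] at this
  exact this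

theorem exists_extension {k m : ℕ} (h : k ≤ m) {s : Node n k} (hs : s ∈ T.level k) :
    ∃ t ∈ T.level m, t.restrict h = s := by
  induction m, h using Nat.le_induction with
  | base => exact ⟨s, hs, rfl⟩
  | succ m hkm ih =>
    obtain ⟨t, ht, hts⟩ := ih
    obtain ⟨f, hf⟩ := succs_nonempty ht
    exact ⟨t.append f, hf, (Node.restrict_append hkm t f).trans hts⟩

theorem level_nonempty (T : Cond ε n) (k : ℕ) : (T.level k).Nonempty := by
  obtain ⟨s, hs⟩ := T.nonempty
  obtain ⟨t, ht, _⟩ := exists_extension (Nat.zero_le k) hs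
  exact ⟨t, ht⟩

/-- The condition `T_s`: all elements of `T` compatible with `s`. -/
def below (T : Cond ε n) {m : ℕ} (s : Node n m) (hs : s ∈ T.level m) : Cond ε n where
  level k := {t | t ∈ T.level k ∧ s.Compat t}
  restrict_mem h t ht := ⟨T.restrict_mem h t ht.1, ht.2.restrict h⟩
  nonempty := ⟨s.restrict (Nat.zero_le m), T.restrict_mem _ _ hs, fun j hj => absurd hj (by simp)⟩
  perfect k t ht := by
    -- Pass to an extension of `t` beyond the length of `s`, where the trees agree.
    have key : ∃ (l : ℕ) (h : k ≤ l) (_ : m ≤ l) (u : Node n l), u ∈ T.level l ∧ s.Compat u ∧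
        u.restrict h = t := by
      rcases le_total k m with h | h
      · exact ⟨m, h, le_rfl, s, hs, fun _ _ _ => rfl, ((Node.compat_iff_of_ge h).1 ht.2).symm⟩
      · exact ⟨k, le_rfl, h, t, ht.1, ht.2, rfl⟩
    obtain ⟨l, hkl, hml, u, hu, hsu, hut⟩ := key
    obtain ⟨r, hlr, v, hv, hvu, hn⟩ := T.perfect l u hu
    have hsv : v.restrict (hml.trans hlr) = s := by
      rw [← (Node.compat_iff_of_le hml).1 hsu, ← hvu]; rfl
    refine ⟨r, hkl.trans hlr, v, ⟨hv, (Node.compat_iff_of_le _).2 hsv⟩, ?_, ?_⟩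
    · rw [← hut, ← hvu]; rfl
    · refine hn.mono fun f hf => ⟨hf, ?_⟩
      exact ((Node.compat_iff_of_le _).2 hsv).append (hml.trans hlr) f
  norm_tendsto M := by
    filter_upwards [T.norm_tendsto M, eventually_ge_atTop m] with k hk hmk t ht
    have : succs (fun k => {t | t ∈ T.level k ∧ s.Compat t}) t = succs T.level t := by
      ext f
      refine ⟨fun hf => hf.1, fun hf => ⟨hf, ht.2.append hmk f⟩⟩
    rw [this]
    exact hk t ht.1

theorem below_le {m : ℕ} {s : Node n m} (hs : s ∈ T.level m) : T.below s hs ≤ T := fun _ _ h => h.1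

theorem self_mem_below {m : ℕ} {s : Node n m} (hs : s ∈ T.level m) : s ∈ (T.below s hs).level m :=
  ⟨hs, fun _ _ _ => rfl⟩

theorem eq_of_mem_below {m : ℕ} {s t : Node n m} {hs : s ∈ T.level m} (ht : t ∈ (T.below s hs).level m) :
    t = s :=
  (Node.compat_iff_of_le le_rfl).1 ht.2

theorem below_mono (h : T ≤ S) {m : ℕ} {s : Node n m} (hs : s ∈ T.level m) :
    T.below s hs ≤ S.below s (h m hs) := fun k _ ht => ⟨h k ht.1, ht.2⟩

theorem below_restrict_le {k m : ℕ} (h : k ≤ m) {s : Node n m} (hs : s ∈ T.level m) :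
    T.below s hs ≤ T.below (s.restrict h) (T.restrict_mem h s hs) :=
  fun _ _ ht => ⟨ht.1, fun j h1 h2 => ht.2 j h1 (h2.trans_le h)⟩

theorem le_below {m : ℕ} {s : Node n m} (hs : s ∈ S.level m) (hT : T ≤ S)
    (h : ∀ t ∈ T.level m, t = s) : T ≤ S.below s hs := by
  refine fun k t ht => ⟨hT k ht, ?_⟩
  rcases le_total k m with hkm | hmk
  · obtain ⟨u, hu, hut⟩ := exists_extension hkm ht
    rw [Node.compat_iff_of_ge hkm, ← hut, h u hu]
  · exact (Node.compat_iff_of_le hmk).2 (h _ (T.restrict_mem hmk t ht))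

theorem succs_below {k m : ℕ} {s : Node n m} {hs : s ∈ T.level m} {t : Node n k} (h : m ≤ k)
    (ht : t ∈ (T.below s hs).level k) : succs (T.below s hs).level t = succs T.level t := by
  ext f
  refine ⟨fun hf => hf.1, fun hf => ⟨hf, ht.2.append h f⟩⟩

end Cond

end PgForcing

/-! ### Densities and norms -/

namespace PgForcing

variable {ε : ℕ → ℕ → ℝ} {n : ℕ → ℕ}

namespace IsEpsSeq

theorem mono (hε : IsEpsSeq ε) {k j l : ℕ} (hjl : j ≤ l) (hl : l ≤ k) : ε k j ≤ ε k l := by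
  induction l, hjl using Nat.le_induction with
  | base => exact le_rfl
  | succ l _ ih => exact (ih (by omega)).trans (hε.lt_succ k l (by omega)).le

theorem pos' (hε : IsEpsSeq ε) {k l : ℕ} (hl : l ≤ k) : 0 < ε k l :=
  (hε.pos k).trans_le (hε.mono (Nat.zero_le l) hl)

theorem le_top (hε : IsEpsSeq ε) {k l : ℕ} (hl : l ≤ k) : ε k l ≤ 1 / 2 ^ k :=
  (hε.mono hl le_rfl).trans (hε.top_le k)

theorem le_one (hε : IsEpsSeq ε) {k l : ℕ} (hl : l ≤ k) : ε k l ≤ 1 :=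
  (hε.le_top hl).trans (div_le_one_of_le₀ (one_le_pow₀ (by norm_num)) (by positivity))

theorem mul_le (hε : IsEpsSeq ε) {k l c : ℕ} (hl : l < k) (hc : c ≤ 2 ^ (k ^ 2)) :
    c * ε k l ≤ ε k (l + 1) := by
  have h1 := (lt_div_iff₀ (by positivity)).1 (hε.lt_div k l hl)
  have h2 : (c : ℝ) ≤ 2 ^ (k ^ 2) := by exact_mod_cast hc
  nlinarith [hε.pos' hl.le]

end IsEpsSeq

/-- The proportion of the elements of `F_k` which lie in `A`. -/
noncomputable def density {k : ℕ} (A : Set (Fn n k)) : ℝ := (A.ncard : ℝ) / Nat.card (Fn n k)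

section

variable {k : ℕ}

theorem density_mono {A B : Set (Fn n k)} (h : A ⊆ B) : density A ≤ density B := by
  unfold density
  gcongr
  exact Set.toFinite B

theorem density_union_le (A B : Set (Fn n k)) : density (A ∪ B) ≤ density A + density B := by
  rw [density, density, density, ← add_div]
  gcongr
  exact_mod_cast Set.ncard_union_le A B

theorem density_biUnion_le {C : Type*} (s : Finset C) (A : C → Set (Fn n k)) :
    density (⋃ c ∈ s, A c) ≤ ∑ c ∈ s, density (A c) := by
  classical
  induction s using Finset.induction_on with
  | empty => simp [density]
  | insert c s hc ih =>
    rw [Finset.set_biUnion_insert, Finset.sum_insert hc]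
    exact (density_union_le _ _).trans (by gcongr)

theorem nor_bddAbove (A : Set (Fn n k)) :
    BddAbove {l : ℕ | l ≤ k ∧ ε k l ≤ (A.ncard : ℝ) / Nat.card (Fn n k)} :=
  ⟨k, fun _ hl => hl.1⟩

theorem nor_le (A : Set (Fn n k)) : nor ε A ≤ k := csSup_le' fun _ hl => hl.1

theorem le_nor {l : ℕ} (hl : l ≤ k) {A : Set (Fn n k)} (h : ε k l ≤ density A) : l ≤ nor ε A :=
  le_csSup (nor_bddAbove A) ⟨hl, h⟩

theorem le_density_of_le_nor (hε : IsEpsSeq ε) {l : ℕ} (hl : 1 ≤ l) {A : Set (Fn n k)}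
    (h : l ≤ nor ε A) : ε k l ≤ density A := by
  have hne : {l : ℕ | l ≤ k ∧ ε k l ≤ (A.ncard : ℝ) / Nat.card (Fn n k)}.Nonempty := by
    by_contra hne
    rw [Set.not_nonempty_iff_eq_empty] at hne
    rw [nor, hne, csSup_empty] at h
    exact absurd h (by simp; omega)
  have := Nat.sSup_mem hne (nor_bddAbove A)
  exact (hε.mono h this.1).trans this.2

theorem nor_mono {A B : Set (Fn n k)} (h : A ⊆ B) : nor ε A ≤ nor ε B :=
  csSup_le' fun _ hl => le_nor hl.1 (hl.2.trans (density_mono h))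

theorem nonempty_of_one_le_nor (hε : IsEpsSeq ε) {A : Set (Fn n k)} (h : 1 ≤ nor ε A) :
    A.Nonempty := by
  rw [Set.nonempty_iff_ne_empty]
  rintro rfl
  have := le_density_of_le_nor hε le_rfl h
  have h2 := hε.pos' (h.trans (nor_le _))
  simp [density] at this
  linarith

/-- A partition into at most `2^(k^2)` pieces has a piece whose norm is smaller by at most one. -/
theorem exists_nor_piece (hε : IsEpsSeq ε) {C : Type*} [Finite C] (hC : Nat.card C ≤ 2 ^ (k ^ 2))
    {A : Set (Fn n k)} (B : C → Set (Fn n k)) (hA : A ⊆ ⋃ c, B c) (h : 1 ≤ nor ε A) :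
    ∃ c, (B c).Nonempty ∧ nor ε A ≤ nor ε (B c) + 1 := by
  have := Fintype.ofFinite C
  obtain ⟨l, hl⟩ : ∃ l, nor ε A = l + 1 := ⟨nor ε A - 1, by omega⟩
  have hlk : l < k := by have := nor_le (ε := ε) A; omega
  have hd := le_density_of_le_nor hε (by omega) hl.ge
  have : ∃ c, ε k l ≤ density (B c) := by
    by_contra! hcon
    have hA' : A ⊆ ⋃ c ∈ (Finset.univ : Finset C), B c := by simpa using hA
    have hle := (density_mono hA').trans (density_biUnion_le _ _)
    obtain ⟨f, hf⟩ := nonempty_of_one_le_nor hε h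
    obtain ⟨c, _⟩ := Set.mem_iUnion.1 (hA hf)
    have hlt : ∑ c, density (B c) < ∑ _c : C, ε k l :=
      Finset.sum_lt_sum_of_nonempty ⟨c, Finset.mem_univ c⟩ fun c _ => hcon c
    rw [Finset.sum_const, nsmul_eq_mul, Finset.card_univ, ← Nat.card_eq_fintype_card] at hlt
    linarith [hε.mul_le hlk hC]
  obtain ⟨c, hc⟩ := this
  refine ⟨c, ?_, hl ▸ Nat.succ_le_succ (le_nor hlk.le hc)⟩
  rw [Set.nonempty_iff_ne_empty]
  intro hce
  rw [hce] at hc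
  simp [density] at hc
  linarith [hε.pos' hlk.le]

end

/-- The bound `⌊2^{n_k} 2^{n_k 2^{n_k}} / ε^k_0⌋` on the number of sequences of length `n_{k+1}`
which are bad for some node of length `k`. -/
noncomputable def badBound (ε : ℕ → ℕ → ℝ) (n : ℕ → ℕ) (k : ℕ) : ℕ :=
  ⌊(2 : ℝ) ^ n k * (2 ^ (n k * 2 ^ n k) / ε k 0)⌋₊

namespace IsBlockSeq

variable {g : ℕ → ℕ}

theorem inv_le (hε : IsEpsSeq ε) (k : ℕ) : 1 ≤ 1 / ε k 0 :=
  (one_le_div (hε.pos k)).2 (hε.le_one (Nat.zero_le k))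

theorem floor_le (hg : StrictMono g) (hn : IsBlockSeq g ε n) (k : ℕ) :
    ⌊((k : ℝ) + 1) * 2 ^ n k * (2 ^ (n k * 2 ^ n k) / ε k 0)⌋₊ ≤ n (k + 1) :=
  (hg.le_apply).trans (hn.large k)

theorem inv_lt_card (hg : StrictMono g) (hε : IsEpsSeq ε) (hn : IsBlockSeq g ε n) (k : ℕ) :
    1 / ε k 0 < Nat.card (Fn n k) := by
  have h0 := hε.pos k
  have h1 := inv_le hε k
  have hq : ⌊1 / ε k 0⌋₊ + n k ≤ n (k + 1) := by
    refine le_trans ?_ (floor_le hg hn k)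
    rw [← Nat.floor_add_natCast (by positivity)]
    apply Nat.floor_le_floor
    have e1 : (n k : ℝ) + 1 ≤ 2 ^ n k := by exact_mod_cast Nat.lt_two_pow_self
    have e2 : (1 : ℝ) ≤ 2 ^ (n k * 2 ^ n k) := one_le_pow₀ (by norm_num)
    calc 1 / ε k 0 + n k ≤ 1 / ε k 0 + n k * (1 / ε k 0) := by
          gcongr; exact le_mul_of_one_le_right (by positivity) h1
      _ = 1 * ((n k : ℝ) + 1) * (1 / ε k 0) := by ring
      _ ≤ ((k : ℝ) + 1) * 2 ^ n k * (2 ^ (n k * 2 ^ n k) / ε k 0) := by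
          gcongr
          linarith [(Nat.cast_nonneg k : (0 : ℝ) ≤ k)]
  have hc : Nat.card (Fn n k) = 2 ^ 2 ^ (n (k + 1) - n k) := by
    simp [Nat.card_eq_fintype_card, Fn, Block]
  have h2 : ⌊1 / ε k 0⌋₊ + 1 ≤ Nat.card (Fn n k) := by
    rw [hc]
    calc ⌊1 / ε k 0⌋₊ + 1 ≤ (n (k + 1) - n k) + 1 := by omega
      _ ≤ 2 ^ (n (k + 1) - n k) := Nat.lt_two_pow_self
      _ ≤ _ := Nat.lt_two_pow_self.le
  exact (Nat.lt_floor_add_one _).trans_le (by exact_mod_cast h2)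

/-- A set of positive norm has at least two elements, since `F_k` has more than `1 / ε^k_0`. -/
theorem nontrivial_of_one_le_nor (hg : StrictMono g) (hε : IsEpsSeq ε) (hn : IsBlockSeq g ε n)
    {k : ℕ} {A : Set (Fn n k)} (h : 1 ≤ nor ε A) : A.Nontrivial := by
  by_contra hA
  rw [Set.not_nontrivial_iff] at hA
  have h1 : (A.ncard : ℝ) ≤ 1 := by exact_mod_cast (Set.ncard_le_one_iff_subsingleton).2 hA
  have h2 := le_density_of_le_nor hε le_rfl h
  have hk : 1 ≤ k := h.trans (nor_le _)
  have hcard := inv_lt_card hg hε hn k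
  have h0 := hε.pos k
  have h3 := hε.mono (Nat.zero_le 1) hk
  rw [density, le_div_iff₀ (by exact_mod_cast Nat.card_pos)] at h2
  rw [div_lt_iff₀ h0] at hcard
  nlinarith

end IsBlockSeq

end PgForcing

/-! ### Constructions of conditions -/

namespace PgForcing

variable {ε : ℕ → ℕ → ℝ} {n : ℕ → ℕ} {g : ℕ → ℕ}

namespace Cond

/-- Perfectness of the tree need not be checked separately: it follows from the growth of the norms. -/
theorem exists_of_norm_tendsto (hg : StrictMono g) (hε : IsEpsSeq ε) (hn : IsBlockSeq g ε n)
    (L : (k : ℕ) → Set (Node n k))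
    (hr : ∀ {k m : ℕ} (h : k ≤ m) (s : Node n m), s ∈ L m → s.restrict h ∈ L k)
    (h0 : (L 0).Nonempty) (hs : ∀ k, ∀ s ∈ L k, (succs L s).Nonempty)
    (hL : ∀ M : ℕ, ∀ᶠ k in atTop, ∀ s ∈ L k, M ≤ nor ε (succs L s)) :
    ∃ T : Cond ε n, T.level = L := by
  refine ⟨⟨L, hr, h0, fun k s hsk => ?_, hL⟩, rfl⟩
  obtain ⟨m, hm, hkm⟩ := ((hL 1).and (eventually_ge_atTop k)).exists
  have key : ∃ t ∈ L m, t.restrict hkm = s := by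
    clear hm
    induction m, hkm using Nat.le_induction with
    | base => exact ⟨s, hsk, rfl⟩
    | succ m hkm ih =>
      obtain ⟨t, ht, hts⟩ := ih
      obtain ⟨f, hf⟩ := hs m t ht
      exact ⟨t.append f, hf, (Node.restrict_append hkm t f).trans hts⟩
  obtain ⟨t, ht, hts⟩ := key
  exact ⟨m, hkm, t, ht, hts, hn.nontrivial_of_one_le_nor hg hε (hm t ht)⟩

/-- The tree in which the set of the immediate successors of each node `s` is `S s`. -/
def genLevel (S : (k : ℕ) → Node n k → Set (Fn n k)) : (k : ℕ) → Set (Node n k)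
  | 0 => Set.univ
  | k + 1 => {s | s.init ∈ genLevel S k ∧ s (Fin.last k) ∈ S k s.init}

theorem succs_genLevel {S : (k : ℕ) → Node n k → Set (Fn n k)} {k : ℕ} {s : Node n k}
    (hs : s ∈ genLevel S k) : succs (genLevel S) s = S k s := by
  ext f
  simp [succs, genLevel, hs]

/-- A tree is a condition if its sets of successors are nonempty and have norms tending to infinity. -/
theorem exists_of_succs (hg : StrictMono g) (hε : IsEpsSeq ε) (hn : IsBlockSeq g ε n)
    (S : (k : ℕ) → Node n k → Set (Fn n k)) (hs : ∀ k, ∀ s ∈ genLevel S k, (S k s).Nonempty)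
    (hS : ∀ M : ℕ, ∀ᶠ k in atTop, ∀ s ∈ genLevel S k, M ≤ nor ε (S k s)) :
    ∃ T : Cond ε n, T.level = genLevel S := by
  refine exists_of_norm_tendsto hg hε hn _ ?_ ⟨fun j => j.elim0, trivial⟩ ?_ ?_
  · intro k m h s hsm
    induction m, h using Nat.le_induction with
    | base => exact hsm
    | succ m hkm ih => exact ih s.init hsm.1
  · intro k s hsk
    rw [succs_genLevel hsk]
    exact hs k s hsk
  · intro M
    filter_upwards [hS M] with k hk s hsk
    rw [succs_genLevel hsk]
    exact hk s hsk

/-- The union of finitely many conditions is a condition. -/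
def iUnion {I : Type*} [Finite I] [Nonempty I] (T : I → Cond ε n) : Cond ε n where
  level k := ⋃ i, (T i).level k
  restrict_mem h s hs :=
    let ⟨i, hi⟩ := Set.mem_iUnion.1 hs
    Set.mem_iUnion.2 ⟨i, (T i).restrict_mem h s hi⟩
  nonempty :=
    let ⟨s, hs⟩ := (T (Classical.arbitrary I)).nonempty
    ⟨s, Set.mem_iUnion.2 ⟨_, hs⟩⟩
  perfect k s hs :=
    let ⟨i, hi⟩ := Set.mem_iUnion.1 hs
    let ⟨m, h, t, ht, hts, hn⟩ := (T i).perfect k s hi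
    ⟨m, h, t, Set.mem_iUnion.2 ⟨i, ht⟩, hts, hn.mono fun _ hf => Set.mem_iUnion.2 ⟨i, hf⟩⟩
  norm_tendsto M := by
    filter_upwards [eventually_all.2 fun i => (T i).norm_tendsto M] with k hk s hs
    obtain ⟨i, hi⟩ := Set.mem_iUnion.1 hs
    exact (hk i s hi).trans (nor_mono fun _ hf => Set.mem_iUnion.2 ⟨i, hf⟩)

section iUnion

variable {I : Type*} [Finite I] [Nonempty I] {T : I → Cond ε n}

theorem mem_iUnion {k : ℕ} {s : Node n k} :
    s ∈ (iUnion T).level k ↔ ∃ i, s ∈ (T i).level k := Set.mem_iUnion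

theorem le_iUnion (i : I) : T i ≤ iUnion T := fun _ _ hs => mem_iUnion.2 ⟨i, hs⟩

theorem iUnion_le {S : Cond ε n} (h : ∀ i, T i ≤ S) : iUnion T ≤ S := fun k _ hs =>
  let ⟨i, hi⟩ := mem_iUnion.1 hs
  h i k hi

end iUnion

/-- From level `m` on, all sets of successors in `T` have norm at least `h`. -/
def NormGe (T : Cond ε n) (m h : ℕ) : Prop :=
  ∀ k, m ≤ k → ∀ s ∈ T.level k, h ≤ nor ε (succs T.level s)

theorem exists_normGe (T : Cond ε n) (h : ℕ) : ∃ m, T.NormGe m h := by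
  obtain ⟨m, hm⟩ := eventually_atTop.1 (T.norm_tendsto h)
  exact ⟨m, hm⟩

theorem NormGe.iUnion {I : Type*} [Finite I] [Nonempty I] {T : I → Cond ε n} {m h : ℕ}
    (H : ∀ i, (T i).NormGe m h) : (Cond.iUnion T).NormGe m h := by
  intro k hk s hs
  obtain ⟨i, hi⟩ := mem_iUnion.1 hs
  exact (H i k hk s hi).trans (nor_mono (succs_mono (le_iUnion i) s))

theorem NormGe.below {T : Cond ε n} {m h k : ℕ} (H : T.NormGe m h) (hmk : m ≤ k) {s : Node n k}
    (hs : s ∈ T.level k) : (T.below s hs).NormGe k h := by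
  intro l hl t ht
  rw [succs_below hl ht]
  exact H l (hmk.trans hl) t ht.1

end Cond

/-! ### Pure decision and continuous reading of names -/

/-- A question with the two possible answers `φ true` and `φ false`, such as the value of a bit of a
name: the conditions forcing an answer are dense, and no condition forces both. -/
structure IsDecision (φ : Bool → Forcing.Sentence (Cond ε n)) : Prop where
  regular : ∀ c, Forcing.IsRegular (φ c)
  dense : ∀ T, ∃ T' ≤ T, ∃ c, φ c T'
  unique : ∀ {T b c}, φ b T → φ c T → b = c

namespace Cond

/-- `T_s` has a subtree with the same stem `s` and norms at least `h` above `s` which forces one of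
the sentences `φ c`. -/
def Good (φ : Bool → Forcing.Sentence (Cond ε n)) (h : ℕ) (T : Cond ε n) {k : ℕ}
    (s : Node n k) (c : Bool) : Prop :=
  ∃ T' ≤ T, s ∈ T'.level k ∧ (∀ t ∈ T'.level k, t = s) ∧ T'.NormGe k h ∧ φ c T'

/-- If the set of successors which are good with a fixed decision is large, the node is good. -/
theorem Good.of_succs {φ : Bool → Forcing.Sentence (Cond ε n)}
    (hφ : IsDecision φ) {h : ℕ} {T : Cond ε n} {k : ℕ} {s : Node n k} {c : Bool}
    {B : Set (Fn n k)} (hB : ∀ f ∈ B, Good φ h T (s.append f) c) (hne : B.Nonempty)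
    (hh : h ≤ nor ε B) : Good φ h T s c := by
  have : Nonempty (Cond ε n) := ⟨T⟩
  choose! T' hT' hmem huniq hnorm hforce using hB
  have : Nonempty B := hne.to_subtype
  have hinit : ∀ f ∈ B, ∀ t ∈ (T' f).level k, t = s := by
    intro f hf t ht
    obtain ⟨u, hu, rfl⟩ := exists_extension (Nat.le_succ k) ht
    rw [huniq f hf u hu]
    exact Node.init_append s f
  have hmemB : ∀ f ∈ B, s ∈ (T' f).level k := fun f hf => by
    simpa using mem_init (hmem f hf)
  refine ⟨iUnion fun f : B => T' f, iUnion_le fun f => hT' f f.2, ?_, ?_, ?_, ?_⟩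
  · obtain ⟨f, hf⟩ := hne
    exact mem_iUnion.2 ⟨⟨f, hf⟩, hmemB f hf⟩
  · intro t ht
    obtain ⟨f, hf⟩ := mem_iUnion.1 ht
    exact hinit f f.2 t hf
  · intro l hl t ht
    obtain ⟨f, hf⟩ := mem_iUnion.1 ht
    rcases hl.eq_or_lt with rfl | hl
    · obtain rfl := hinit f f.2 t hf
      exact hh.trans (nor_mono fun f' hf' => mem_iUnion.2 ⟨⟨f', hf'⟩, hmem f' hf'⟩)
    · exact (hnorm f f.2 l hl t hf).trans (nor_mono
        (succs_mono (le_iUnion (T := fun f : B => T' f) f) t))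
  · refine (hφ.regular c).of_dense fun R hR => ?_
    obtain ⟨t, ht⟩ := R.level_nonempty (k + 1)
    obtain ⟨f, hf⟩ := mem_iUnion.1 (hR _ ht)
    refine ⟨R.below t ht, below_le ht, (hφ.regular c).mono ?_ (hforce f f.2)⟩
    have htf := huniq f f.2 t hf
    intro l u hu
    obtain ⟨f', hf'⟩ := mem_iUnion.1 (hR _ hu.1)
    rcases le_total (k + 1) l with hl | hl
    · have h1 := (Node.compat_iff_of_le hl).1 hu.2
      have h2 := huniq f' f'.2 _ ((T' f').restrict_mem hl u hf')
      have h3 : f' = f := Subtype.ext <| by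
        have := congrArg (fun v : Node n (k + 1) => v (Fin.last k)) (h2.symm.trans (h1.trans htf))
        simpa using this
      exact h3 ▸ hf'
    · rw [(Node.compat_iff_of_ge hl).1 hu.2]
      exact (T' f).restrict_mem hl t hf

/-- Pure decision: if all norms above `s` are greater than `h`, then `s` is good.  Otherwise the tree
of all extensions of `s` which are not good is a condition; a stronger condition makes a decision, and
its nodes far up are good. -/
theorem exists_good (hg : StrictMono g) (hε : IsEpsSeq ε) (hn : IsBlockSeq g ε n)
    {φ : Bool → Forcing.Sentence (Cond ε n)} (hφ : IsDecision φ) {h m : ℕ} (hm : 2 ≤ m)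
    {T : Cond ε n} (hT : T.NormGe m (h + 1)) {s : Node n m} (hs : s ∈ T.level m) :
    ∃ c, Good φ h T s c := by
  by_contra hbad
  -- A node which is not good has a large set of successors which are not good.
  have step : ∀ k, m ≤ k → ∀ t ∈ T.level k, (¬ ∃ c, Good φ h T t c) →
      {f ∈ succs T.level t | ¬ ∃ c, Good φ h T (t.append f) c}.Nonempty ∧
      nor ε (succs T.level t) ≤
        nor ε {f ∈ succs T.level t | ¬ ∃ c, Good φ h T (t.append f) c} + 1 := by
    intro k hk t ht htbad
    have hcard : Nat.card (Option Bool) ≤ 2 ^ (k ^ 2) := by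
      rw [Finite.card_option, Nat.card_eq_fintype_card, Fintype.card_bool]
      exact le_trans (by norm_num : 2 + 1 ≤ 2 ^ 4) (Nat.pow_le_pow_right (by norm_num) (by nlinarith))
    obtain ⟨o, hne, ho⟩ := exists_nor_piece hε hcard
      (A := succs T.level t)
      (fun o => {f ∈ succs T.level t | o.elim (¬ ∃ c, Good φ h T (t.append f) c)
        fun c => Good φ h T (t.append f) c})
      (by
        intro f hf
        by_cases hgood : ∃ c, Good φ h T (t.append f) c
        · obtain ⟨c, hc⟩ := hgood
          exact Set.mem_iUnion.2 ⟨some c, hf, hc⟩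
        · exact Set.mem_iUnion.2 ⟨none, hf, hgood⟩)
      ((Nat.le_add_left 1 h).trans (hT k hk t ht))
    cases o with
    | none => exact ⟨hne, ho⟩
    | some c =>
      refine absurd ⟨c, Good.of_succs hφ (fun f hf => hf.2) hne ?_⟩ htbad
      have := hT k hk t ht
      omega
  -- The tree of the nodes compatible with `s` which are not good extensions of `s`.
  set S : (k : ℕ) → Node n k → Set (Fn n k) := fun k t => {f ∈ succs (T.below s hs).level t |
    m ≤ k → ¬ ∃ c, Good φ h T (t.append f) c} with hS
  have hmem : ∀ k, ∀ t ∈ genLevel S k, t ∈ (T.below s hs).level k ∧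
      (m ≤ k → ¬ ∃ c, Good φ h T t c) := by
    intro k
    induction k with
    | zero =>
      intro t _
      obtain ⟨u, hu⟩ := (T.below s hs).level_nonempty 0
      rw [Subsingleton.elim t u]
      exact ⟨hu, fun h => by omega⟩
    | succ k ih =>
      intro t ht
      have h1 : t ∈ (T.below s hs).level (k + 1) := by
        have := ht.2.1
        rwa [succs, Set.mem_ofPred_eq, Node.init_append_last] at this
      refine ⟨h1, fun hk => ?_⟩
      rcases hk.eq_or_lt with rfl | hk
      · rwa [eq_of_mem_below h1]
      · have := ht.2.2 (Nat.lt_succ_iff.1 hk)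
        rwa [Node.init_append_last] at this
  have hSlow : ∀ k, k < m → ∀ t, S k t = succs (T.below s hs).level t := by
    intro k hk t
    ext f
    exact ⟨fun hf => hf.1, fun hf => ⟨hf, fun h => by omega⟩⟩
  have hShigh : ∀ k, m ≤ k → ∀ t ∈ genLevel S k,
      S k t = {f ∈ succs T.level t | ¬ ∃ c, Good φ h T (t.append f) c} := by
    intro k hk t ht
    ext f
    simp only [hS, succs_below hk (hmem k t ht).1, hk, true_imp_iff]
  obtain ⟨U, hU⟩ : ∃ U : Cond ε n, U.level = genLevel S := by
    refine exists_of_succs hg hε hn S (fun k t ht => ?_) fun M => ?_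
    · rcases lt_or_ge k m with hk | hk
      · rw [hSlow k hk]
        exact succs_nonempty (hmem k t ht).1
      · rw [hShigh k hk t ht]
        exact (step k hk t (hmem k t ht).1.1 ((hmem k t ht).2 hk)).1
    · filter_upwards [T.norm_tendsto (M + 1), eventually_ge_atTop m] with k hM hk t ht
      rw [hShigh k hk t ht]
      have h1 := (step k hk t (hmem k t ht).1.1 ((hmem k t ht).2 hk)).2
      have h2 := hM t (hmem k t ht).1.1
      omega
  obtain ⟨R, hR, c, hc⟩ := hφ.dense U
  obtain ⟨l, hl⟩ := R.exists_normGe h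
  obtain ⟨t, ht⟩ := R.level_nonempty (max l m)
  have hRT : R ≤ T := fun k u hu => (hmem k u (hU ▸ hR k hu)).1.1
  refine (hmem _ t (hU ▸ hR _ ht)).2 (le_max_right l m) ⟨c, R.below t ht, ?_, self_mem_below ht,
    fun u hu => eq_of_mem_below hu, hl.below (le_max_left l m) ht,
    (hφ.regular c).mono (below_le ht) hc⟩
  exact (below_le ht).trans hRT

/-- One step of the fusion: above level `a` the norms drop, but stay at least `h`, below level `a`
nothing changes, and the nodes of length `a` make a decision. -/
theorem exists_fusion_step (hg : StrictMono g) (hε : IsEpsSeq ε) (hn : IsBlockSeq g ε n)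
    {φ : Bool → Forcing.Sentence (Cond ε n)} (hφ : IsDecision φ) {h a : ℕ} (ha : 2 ≤ a)
    {T : Cond ε n} (hT : T.NormGe a (h + 1)) :
    ∃ T' ≤ T, (∀ k ≤ a, T'.level k = T.level k) ∧ T'.NormGe a h ∧
      ∀ (s : Node n a) (hs : s ∈ T'.level a), ∃ c, φ c (T'.below s hs) := by
  have hgood := fun s : T.level a => exists_good hg hε hn hφ ha hT s.2
  choose c T' hT' hmem huniq hnorm hforce using hgood
  have : Nonempty (T.level a) := (T.level_nonempty a).to_subtype
  refine ⟨iUnion T', iUnion_le hT', fun k hk => ?_, .iUnion hnorm, fun s hs => ?_⟩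
  · refine subset_antisymm (iUnion_le hT' k) fun t ht => ?_
    obtain ⟨u, hu, rfl⟩ := exists_extension hk ht
    exact mem_iUnion.2 ⟨⟨u, hu⟩, (T' _).restrict_mem hk u (hmem ⟨u, hu⟩)⟩
  · have hsT : s ∈ T.level a := iUnion_le hT' a hs
    refine ⟨c ⟨s, hsT⟩, (hφ.regular _).mono ?_ (hforce ⟨s, hsT⟩)⟩
    intro l u hu
    obtain ⟨i, hi⟩ := mem_iUnion.1 hu.1
    rcases le_total a l with hl | hl
    · have h1 := (Node.compat_iff_of_le hl).1 hu.2
      have h2 := huniq i _ ((T' i).restrict_mem hl u hi)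
      have h3 : i = ⟨s, hsT⟩ := Subtype.ext (h2.symm.trans h1)
      exact h3 ▸ hi
    · rw [(Node.compat_iff_of_ge hl).1 hu.2]
      exact (T' _).restrict_mem hl s (hmem ⟨s, hsT⟩)

/-- Continuous reading of names: below every condition there is a condition `T` such that for every `i`
the `i`-th decision is made by the nodes of some length. -/
theorem exists_continuous_reading (hg : StrictMono g) (hε : IsEpsSeq ε) (hn : IsBlockSeq g ε n)
    {φ : ℕ → Bool → Forcing.Sentence (Cond ε n)} (hφ : ∀ i, IsDecision (φ i)) (T₀ : Cond ε n) :
    ∃ T ≤ T₀, ∃ N : ℕ → ℕ, ∀ i, ∀ (s : Node n (N i)) (hs : s ∈ T.level (N i)),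
      ∃ c, φ i c (T.below s hs) := by
  -- A stage `i` of the fusion is a condition with norms greater than `i` from some level `a ≥ 2` on.
  let St : ℕ → Type := fun i => {x : Cond ε n × ℕ // 2 ≤ x.2 ∧ x.1.NormGe x.2 (i + 1)}
  have hstep : ∀ i (x : St i), ∃ y : St (i + 1), y.1.1 ≤ x.1.1 ∧ x.1.2 < y.1.2 ∧
      (∀ k ≤ x.1.2, y.1.1.level k = x.1.1.level k) ∧ y.1.1.NormGe x.1.2 i ∧
      ∀ (s : Node n x.1.2) (hs : s ∈ y.1.1.level x.1.2), ∃ c, φ i c (y.1.1.below s hs) := by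
    rintro i ⟨⟨T, a⟩, ha, hT⟩
    obtain ⟨T', h1, h2, h3, h4⟩ := exists_fusion_step hg hε hn (hφ i) ha hT
    obtain ⟨b, hb⟩ := T'.exists_normGe (i + 1 + 1)
    refine ⟨⟨(T', max b (a + 1)), ?_, fun k hk => hb k (le_trans (le_max_left _ _) hk)⟩, h1, ?_, h2,
      h3, h4⟩
    · exact ha.trans ((Nat.le_succ a).trans (le_max_right _ _))
    · exact le_max_right b (a + 1)
  choose next hnext using hstep
  obtain ⟨a₀, ha₀⟩ := T₀.exists_normGe 1
  let F : (i : ℕ) → St i := fun i => Nat.rec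
    ⟨(T₀, max a₀ 2), le_max_right _ _, fun k hk => ha₀ k (le_trans (le_max_left _ _) hk)⟩ next i
  let T : ℕ → Cond ε n := fun i => (F i).1.1
  let a : ℕ → ℕ := fun i => (F i).1.2
  have hTa : ∀ i, T (i + 1) ≤ T i ∧ a i < a (i + 1) ∧
      (∀ k ≤ a i, (T (i + 1)).level k = (T i).level k) ∧ (T (i + 1)).NormGe (a i) i ∧
      ∀ (s : Node n (a i)) (hs : s ∈ (T (i + 1)).level (a i)), ∃ c, φ i c ((T (i + 1)).below s hs) :=
    fun i => hnext i (F i)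
  have hT0 : T 0 = T₀ := rfl
  clear_value T a
  have hanti : Antitone T := antitone_nat_of_succ_le fun i => (hTa i).1
  have ha : StrictMono a := strictMono_nat_of_lt_succ fun i => (hTa i).2.1
  have hstab : ∀ k j, k ≤ j → (T j).level k = (T k).level k := by
    intro k j hkj
    induction j, hkj using Nat.le_induction with
    | base => rfl
    | succ j hkj ih => rw [(hTa j).2.2.1 k (hkj.trans ha.le_apply), ih]
  have hnorm : ∀ i j, i + 1 ≤ j → (T j).NormGe (a i) i := by
    intro i j hij
    induction j, hij using Nat.le_induction with
    | base => exact (hTa i).2.2.2.1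
    | succ j hij ih =>
      intro k hk s hs
      rcases lt_or_ge k (a j) with h | h
      · have h1 := (hTa j).2.2.1 k h.le
        have h2 : succs (T (j + 1)).level s = succs (T j).level s := by
          simp only [succs, (hTa j).2.2.1 (k + 1) h]
        rw [h2]
        exact ih k hk s (h1 ▸ hs)
      · exact le_trans (by omega) ((hTa j).2.2.2.1 k h s hs)
  obtain ⟨U, hU⟩ := exists_of_norm_tendsto hg hε hn (fun k => (T k).level k)
    (fun {k m} h s hs => by
      have := (T m).restrict_mem h s hs
      rwa [hstab k m h] at this)
    (T 0).nonempty
    (fun k s hs => by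
      have hs' : s ∈ (T (k + 1)).level k := by rwa [hstab k (k + 1) (Nat.le_succ k)]
      exact succs_nonempty hs')
    (fun M => by
      filter_upwards [eventually_ge_atTop (a M)] with k hk s hs
      have hs' : s ∈ (T (k + 1)).level k := by rwa [hstab k (k + 1) (Nat.le_succ k)]
      exact hnorm M (k + 1) (Nat.succ_le_succ (ha.le_apply.trans hk)) k hk s hs')
  have hUT : ∀ i, U ≤ T i := by
    intro i k
    rw [hU]
    rcases le_total i k with h | h
    · exact hanti h k
    · exact (hstab k i h).ge
  refine ⟨U, hT0 ▸ hUT 0, a, fun i s hs => ?_⟩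
  obtain ⟨c, hc⟩ := (hTa i).2.2.2.2 s (hUT _ _ hs)
  exact ⟨c, ((hφ i).regular c).mono (below_mono (hUT _) hs) hc⟩

end Cond

end PgForcing

/-! ### Early reading of names -/

namespace PgForcing

variable {ε : ℕ → ℕ → ℝ} {n : ℕ → ℕ} {g : ℕ → ℕ}

/-- König's lemma for a decreasing sequence of nonempty subsets of a finite set. -/
theorem exists_forall_of_antitone {C : Type*} [Finite C] {p : ℕ → C → Prop}
    (hp : ∀ d e c, d ≤ e → p e c → p d c) (h : ∀ d, ∃ c, p d c) : ∃ c, ∀ d, p d c := by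
  by_contra! hcon
  choose d hd using hcon
  obtain ⟨D, hD⟩ := (Set.finite_range d).bddAbove
  obtain ⟨c, hc⟩ := h D
  exact hd c (hp _ _ c (hD ⟨c, rfl⟩) hc)

namespace Cond

variable {φ : ℕ → Bool → Forcing.Sentence (Cond ε n)} {T : Cond ε n} {N : ℕ → ℕ}

/-- `w` is a prediction of the first `k + 1` answers at a node `t` of length `k`, with lookahead `d`:
the answers which `t` decides are as predicted, and, if `d > 0`, a large set of immediate successors of
`t` have a prediction with lookahead `d - 1` which extends `w`. -/
def Predicts (φ : ℕ → Bool → Forcing.Sentence (Cond ε n)) (T : Cond ε n) (N : ℕ → ℕ) :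
    ℕ → {k : ℕ} → Node n k → (Fin (k + 1) → Bool) → Prop
  | 0, k, t, w => ∀ i : Fin (k + 1), N i ≤ k → ∀ ht : t ∈ T.level k, φ i (w i) (T.below t ht)
  | d + 1, k, t, w =>
    {f ∈ succs T.level t | ∃ w' : Fin (k + 2) → Bool, (∀ i, w' i.castSucc = w i) ∧
      Predicts φ T N d (t.append f) w'}.Nonempty ∧
    nor ε (succs T.level t) ≤
      nor ε {f ∈ succs T.level t | ∃ w' : Fin (k + 2) → Bool, (∀ i, w' i.castSucc = w i) ∧
        Predicts φ T N d (t.append f) w'} + 1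

theorem exists_decided (hφ : ∀ i, IsDecision (φ i))
    (hN : ∀ i, ∀ (s : Node n (N i)) (hs : s ∈ T.level (N i)), ∃ c, φ i c (T.below s hs))
    {i k : ℕ} (h : N i ≤ k) {t : Node n k} (ht : t ∈ T.level k) : ∃ c, φ i c (T.below t ht) := by
  obtain ⟨c, hc⟩ := hN i (t.restrict h) (T.restrict_mem h t ht)
  exact ⟨c, ((hφ i).regular c).mono (below_restrict_le h ht) hc⟩

theorem exists_predicts (hε : IsEpsSeq ε) (hφ : ∀ i, IsDecision (φ i))
    (hN : ∀ i, ∀ (s : Node n (N i)) (hs : s ∈ T.level (N i)), ∃ c, φ i c (T.below s hs))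
    {m : ℕ} (hm : 2 ≤ m) (hT : T.NormGe m 1) (d : ℕ) {k : ℕ} (hk : m ≤ k) {t : Node n k}
    (ht : t ∈ T.level k) : ∃ w, Predicts φ T N d t w := by
  induction d generalizing k with
  | zero =>
    have : ∀ i : Fin (k + 1), ∃ b, N i ≤ k → φ i b (T.below t ht) := fun i => by
      by_cases h : N i ≤ k
      · obtain ⟨c, hc⟩ := exists_decided hφ hN h ht
        exact ⟨c, fun _ => hc⟩
      · exact ⟨false, fun h' => absurd h' h⟩
    choose w hw using this
    exact ⟨w, fun i hi _ => hw i hi⟩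
  | succ d ih =>
    have hcard : Nat.card (Fin (k + 1) → Bool) ≤ 2 ^ (k ^ 2) := by
      rw [Nat.card_eq_fintype_card, Fintype.card_fun, Fintype.card_bool, Fintype.card_fin]
      exact Nat.pow_le_pow_right (by norm_num) (by nlinarith)
    obtain ⟨w, hw⟩ := exists_nor_piece hε hcard (A := succs T.level t)
      (fun w => {f ∈ succs T.level t | ∃ w' : Fin (k + 2) → Bool, (∀ i, w' i.castSucc = w i) ∧
        Predicts φ T N d (t.append f) w'})
      (fun f hf => by
        obtain ⟨w', hw'⟩ := ih (hk.trans (Nat.le_succ k)) hf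
        exact Set.mem_iUnion.2 ⟨fun i => w' i.castSucc, hf, w', fun _ => rfl, hw'⟩)
      (hT k hk t ht)
    exact ⟨w, hw⟩

theorem Predicts.of_succ (hφ : ∀ i, IsDecision (φ i))
    (hN : ∀ i, ∀ (s : Node n (N i)) (hs : s ∈ T.level (N i)), ∃ c, φ i c (T.below s hs))
    {d k : ℕ} {t : Node n k} {w : Fin (k + 1) → Bool} (h : Predicts φ T N (d + 1) t w) :
    Predicts φ T N d t w := by
  induction d generalizing k with
  | zero =>
    intro i hi ht
    obtain ⟨f, hf, w', hw', h'⟩ := h.1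
    obtain ⟨b, hb⟩ := exists_decided hφ hN hi ht
    have h1 : φ i (w' i.castSucc) (T.below _ hf) :=
      h' i.castSucc (le_trans hi (Nat.le_succ k)) hf
    have hle : T.below _ hf ≤ T.below t ht := by
      refine le_below ht (below_le hf) fun u hu => ?_
      rw [(Node.compat_iff_of_ge (Nat.le_succ k)).1 hu.2]
      exact Node.init_append t f
    have h2 := (hφ i).unique (((hφ i).regular b).mono hle hb) h1
    rwa [h2, hw'] at hb
  | succ d ih =>
    have hsub : {f ∈ succs T.level t | ∃ w' : Fin (k + 2) → Bool, (∀ i, w' i.castSucc = w i) ∧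
        Predicts φ T N (d + 1) (t.append f) w'} ⊆
        {f ∈ succs T.level t | ∃ w' : Fin (k + 2) → Bool, (∀ i, w' i.castSucc = w i) ∧
        Predicts φ T N d (t.append f) w'} :=
      fun f ⟨hf, w', hw', h'⟩ => ⟨hf, w', hw', ih h'⟩
    exact ⟨h.1.mono hsub, h.2.trans (Nat.succ_le_succ (nor_mono hsub))⟩

theorem Predicts.anti (hφ : ∀ i, IsDecision (φ i))
    (hN : ∀ i, ∀ (s : Node n (N i)) (hs : s ∈ T.level (N i)), ∃ c, φ i c (T.below s hs))
    {d e k : ℕ} {t : Node n k} {w : Fin (k + 1) → Bool} (hde : d ≤ e)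
    (h : Predicts φ T N e t w) : Predicts φ T N d t w := by
  induction e, hde using Nat.le_induction with
  | base => exact h
  | succ e _ ih => exact ih (h.of_succ hφ hN)

/-- A prediction with unbounded lookahead extends to such predictions at many successors. -/
theorem Predicts.succs_large (hφ : ∀ i, IsDecision (φ i))
    (hN : ∀ i, ∀ (s : Node n (N i)) (hs : s ∈ T.level (N i)), ∃ c, φ i c (T.below s hs))
    {k : ℕ} {t : Node n k} {w : Fin (k + 1) → Bool} (h : ∀ d, Predicts φ T N d t w) :
    {f ∈ succs T.level t | ∃ w' : Fin (k + 2) → Bool, (∀ i, w' i.castSucc = w i) ∧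
      ∀ d, Predicts φ T N d (t.append f) w'}.Nonempty ∧
    nor ε (succs T.level t) ≤
      nor ε {f ∈ succs T.level t | ∃ w' : Fin (k + 2) → Bool, (∀ i, w' i.castSucc = w i) ∧
        ∀ d, Predicts φ T N d (t.append f) w'} + 1 := by
  have key : ∀ f : Fn n k, ∃ d, (∃ w' : Fin (k + 2) → Bool, (∀ i, w' i.castSucc = w i) ∧
      Predicts φ T N d (t.append f) w') → ∃ w' : Fin (k + 2) → Bool, (∀ i, w' i.castSucc = w i) ∧
      ∀ d, Predicts φ T N d (t.append f) w' := by
    intro f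
    by_contra! hcon
    obtain ⟨w', hw'⟩ := exists_forall_of_antitone
      (p := fun d (w' : Fin (k + 2) → Bool) => (∀ i, w' i.castSucc = w i) ∧
        Predicts φ T N d (t.append f) w')
      (fun d e c hde hc => ⟨hc.1, hc.2.anti hφ hN hde⟩) fun d => (hcon d).1
    obtain ⟨d, hd⟩ := (hcon 0).2 w' (hw' 0).1
    exact hd (hw' d).2
  choose d hd using key
  obtain ⟨D, hD⟩ := (Set.finite_range d).bddAbove
  have hsub : {f ∈ succs T.level t | ∃ w' : Fin (k + 2) → Bool, (∀ i, w' i.castSucc = w i) ∧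
      Predicts φ T N D (t.append f) w'} ⊆
      {f ∈ succs T.level t | ∃ w' : Fin (k + 2) → Bool, (∀ i, w' i.castSucc = w i) ∧
      ∀ d, Predicts φ T N d (t.append f) w'} :=
    fun f ⟨hf, w', hw', h'⟩ => ⟨hf, hd f ⟨w', hw', h'.anti hφ hN (hD ⟨f, rfl⟩)⟩⟩
  exact ⟨(h (D + 1)).1.mono hsub, (h (D + 1)).2.trans (Nat.succ_le_succ (nor_mono hsub))⟩

/-- A choice of predictions with unbounded lookahead (where there are any) at the nodes of positive
length; beyond length `m` each extends that at the predecessor, whenever this is possible. -/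
noncomputable def prediction (φ : ℕ → Bool → Forcing.Sentence (Cond ε n)) (T : Cond ε n)
    (N : ℕ → ℕ) (m : ℕ) : (k : ℕ) → Node n k → Fin (k + 1) → Bool
  | 0, _ => fun _ => false
  | k + 1, t => Classical.epsilon fun w =>
    (m ≤ k → ∀ i, w i.castSucc = prediction φ T N m k t.init i) ∧ ∀ d, Predicts φ T N d t w

/-- Below every condition there is a condition `T` such that, for almost all `k`, the `k`-th question
is answered by the nodes of length `k` already. -/
theorem exists_early_reading (hg : StrictMono g) (hε : IsEpsSeq ε) (hn : IsBlockSeq g ε n)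
    (hφ : ∀ i, IsDecision (φ i)) (T₀ : Cond ε n) :
    ∃ T ≤ T₀, ∃ (m : ℕ) (c : (k : ℕ) → Node n k → Bool), ∀ k, m ≤ k →
      ∀ (t : Node n k) (ht : t ∈ T.level k), φ k (c k t) (T.below t ht) := by
  obtain ⟨T, hTT₀, N, hN⟩ := exists_continuous_reading hg hε hn hφ T₀
  obtain ⟨m₀, hm₀⟩ := T.exists_normGe 1
  obtain ⟨m, hm, hT⟩ : ∃ m, 2 ≤ m ∧ T.NormGe m 1 :=
    ⟨max m₀ 2, le_max_right _ _, fun k hk => hm₀ k (le_trans (le_max_left _ _) hk)⟩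
  set π := prediction φ T N m
  set S : (k : ℕ) → Node n k → Set (Fn n k) := fun k t => {f ∈ succs T.level t | m ≤ k →
    (∀ i, π (k + 1) (t.append f) i.castSucc = π k t i) ∧
      ∀ d, Predicts φ T N d (t.append f) (π (k + 1) (t.append f))} with hS
  have hmem : ∀ k, ∀ t ∈ genLevel S k, t ∈ T.level k ∧
      (m ≤ k → ∀ d, Predicts φ T N d t (π k t)) := by
    intro k
    induction k with
    | zero =>
      intro t _
      obtain ⟨u, hu⟩ := T.level_nonempty 0
      rw [Subsingleton.elim t u]
      exact ⟨hu, fun h => by omega⟩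
    | succ k ih =>
      intro t ht
      have h1 : t ∈ T.level (k + 1) := by
        have := ht.2.1
        rwa [succs, Set.mem_ofPred_eq, Node.init_append_last] at this
      refine ⟨h1, fun hk => ?_⟩
      rcases hk.eq_or_lt with rfl | hk
      · have hex : ∃ w, ∀ d, Predicts φ T N d t w :=
          exists_forall_of_antitone (fun d e c hde hc => hc.anti hφ hN hde) fun d =>
            exists_predicts hε hφ hN hm hT d le_rfl h1
        obtain ⟨w, hw⟩ := hex
        exact (Classical.epsilon_spec (p := fun w =>
          (k + 1 ≤ k → ∀ i, w i.castSucc = prediction φ T N (k + 1) k t.init i) ∧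
            ∀ d, Predicts φ T N d t w) ⟨w, fun h => by omega, hw⟩).2
      · have := (ht.2.2 (Nat.lt_succ_iff.1 hk)).2
        rwa [Node.init_append_last] at this
  have hlow : ∀ k, k < m → ∀ t, S k t = succs T.level t := by
    intro k hk t
    ext f
    exact ⟨fun hf => hf.1, fun hf => ⟨hf, fun h => by omega⟩⟩
  have hhigh : ∀ k, m ≤ k → ∀ t ∈ genLevel S k,
      (S k t).Nonempty ∧ nor ε (succs T.level t) ≤ nor ε (S k t) + 1 := by
    intro k hk t ht
    have h := Predicts.succs_large hφ hN ((hmem k t ht).2 hk)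
    have hsub : {f ∈ succs T.level t | ∃ w' : Fin (k + 2) → Bool,
        (∀ i, w' i.castSucc = π k t i) ∧ ∀ d, Predicts φ T N d (t.append f) w'} ⊆ S k t := by
      rintro f ⟨hf, w', hw', h'⟩
      have := Classical.epsilon_spec (p := fun w =>
          (m ≤ k → ∀ i, w i.castSucc = π k (t.append f).init i) ∧
            ∀ d, Predicts φ T N d (t.append f) w) ⟨w', by simpa using fun _ => hw', h'⟩
      exact ⟨hf, fun _ => ⟨fun i => (this.1 hk i).trans
        (congrArg (fun v => π k v i) (Node.init_append t f)), this.2⟩⟩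
    exact ⟨h.1.mono hsub, h.2.trans (Nat.succ_le_succ (nor_mono hsub))⟩
  obtain ⟨U, hU⟩ : ∃ U : Cond ε n, U.level = genLevel S := by
    refine exists_of_succs hg hε hn S (fun k t ht => ?_) fun M => ?_
    · rcases lt_or_ge k m with hk | hk
      · rw [hlow k hk]
        exact succs_nonempty (hmem k t ht).1
      · exact (hhigh k hk t ht).1
    · filter_upwards [T.norm_tendsto (M + 1), eventually_ge_atTop m] with k hM hk t ht
      have h1 := (hhigh k hk t ht).2
      have h2 := hM t (hmem k t ht).1
      omega
  have hUT : U ≤ T := fun k t ht => (hmem k t (hU ▸ ht)).1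
  -- Along a branch of the new tree the predictions extend each other.
  have hext : ∀ k l (hkl : k ≤ l), m ≤ k → ∀ t ∈ U.level l, ∀ i (hi : i < k + 1),
      π l t ⟨i, hi.trans_le (Nat.succ_le_succ hkl)⟩ = π k (t.restrict hkl) ⟨i, hi⟩ := by
    intro k l hkl hmk
    induction l, hkl using Nat.le_induction with
    | base => exact fun t _ i hi => rfl
    | succ l hkl ih =>
      intro t ht i hi
      have ht' : t ∈ genLevel S (l + 1) := hU ▸ ht
      have h1 := (ht'.2.2 (hmk.trans hkl)).1 ⟨i, hi.trans_le (Nat.succ_le_succ hkl)⟩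
      rw [Node.init_append_last] at h1
      exact h1.trans (ih t.init (mem_init ht) i hi)
  refine ⟨U, hUT.trans hTT₀, m, fun k t => π k t (Fin.last k), fun k hk t ht => ?_⟩
  refine ((hφ k).regular _).of_dense fun R hR => ?_
  have hkl : k ≤ max k (N k) := le_max_left _ _
  obtain ⟨u, hu⟩ := R.level_nonempty (max k (N k))
  have huU := hR _ hu
  have h1 := (hmem _ u (hU ▸ huU.1)).2 (hk.trans hkl) 0 ⟨k, by omega⟩ (le_max_right _ _)
    (hUT _ huU.1)
  have h2 := hext k _ hkl hk u huU.1 k (Nat.lt_succ_self k)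
  rw [h2, (Node.compat_iff_of_le hkl).1 huU.2] at h1
  refine ⟨R.below u hu, below_le hu, ((hφ k).regular _).mono ?_ h1⟩
  exact below_mono (hR.trans ((below_le ht).trans hUT)) hu

end Cond

end PgForcing

/-! ### Bad blocks and strong measure zero -/

namespace PgForcing

variable {ε : ℕ → ℕ → ℝ} {n : ℕ → ℕ} {g : ℕ → ℕ}

theorem density_forall_eq {k : ℕ} (U : Finset (Block n k)) (b : Bool) :
    density {f : Fn n k | ∀ u ∈ U, f u = b} = 1 / 2 ^ U.card := by
  classical
  have h1 : {f : Fn n k | ∀ u ∈ U, f u = b} =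
      ↑(Fintype.piFinset fun u => if u ∈ U then ({b} : Finset Bool) else Finset.univ) := by
    ext f
    simp only [Set.mem_ofPred_eq, Finset.mem_coe, Fintype.mem_piFinset]
    refine forall_congr' fun u => ?_
    by_cases hu : u ∈ U <;> simp [hu]
  have h2 : ∏ u : Block n k, (if u ∈ U then ({b} : Finset Bool) else Finset.univ).card =
      2 ^ Uᶜ.card := by
    simp only [apply_ite Finset.card, Finset.card_singleton, Finset.card_univ, Fintype.card_bool]
    rw [Finset.prod_ite, Finset.prod_const_one, one_mul, Finset.prod_const]
    congr 2
    ext u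
    simp
  have h3 : Fintype.card (Block n k) = U.card + Uᶜ.card := (Finset.card_add_card_compl U).symm
  rw [density, h1, Set.ncard_coe_finset, Fintype.card_piFinset, h2, Nat.card_eq_fintype_card,
    Fintype.card_fun, Fintype.card_bool, h3, pow_add]
  push_cast
  field_simp

/-- The arguments `u` at which the value of `f ∈ A` cannot be prescribed without reducing the norm by
more than one. -/
def badSet (ε : ℕ → ℕ → ℝ) {k : ℕ} (A : Set (Fn n k)) : Set (Block n k) :=
  {u | ∃ b, nor ε {f ∈ A | f u = b} + 1 < nor ε A}

/-- If the value `b` were rare in `A` at `m` points, nearly all of `A` would be constant on these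
points, and the density of `A` would be at most about `2 ^ (-m)`. -/
theorem card_rare_lt (hε : IsEpsSeq ε) {k l : ℕ} (hk : 2 ≤ k) (hl : l < k) {A : Set (Fn n k)}
    (hA : ε k (l + 1) ≤ density A) (b : Bool) :
    {u : Block n k | density {f ∈ A | f u = b} < ε k l}.ncard < ⌈1 / ε k (l + 1)⌉₊ + 1 := by
  set e := ε k (l + 1)
  set m := ⌈1 / e⌉₊ + 1 with hm
  by_contra! hcon
  have he : 0 < e := hε.pos' hl
  have he4 : e ≤ 1 / 4 := (hε.le_top hl).trans <| by
    rw [div_le_div_iff_of_pos_left one_pos (by positivity) (by norm_num)]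
    calc (4 : ℝ) = 2 ^ 2 := by norm_num
      _ ≤ 2 ^ k := pow_le_pow_right₀ (by norm_num) hk
  have hcube : ε k l < e ^ 3 := hε.lt_cube k l hl
  rw [Set.ncard_eq_toFinset_card'] at hcon
  obtain ⟨U, hU, hUm⟩ := Finset.exists_subset_card_eq hcon
  have hsub : A ⊆ {f : Fn n k | ∀ u ∈ U, f u = !b} ∪ ⋃ u ∈ U, {f ∈ A | f u = b} := by
    intro f hf
    by_cases h : ∀ u ∈ U, f u = !b
    · exact Or.inl h
    · push Not at h
      obtain ⟨u, hu, hfu⟩ := h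
      refine Or.inr (Set.mem_biUnion hu ⟨hf, ?_⟩)
      cases b <;> simpa using hfu
  have h1 := (density_mono hsub).trans (density_union_le _ _)
  have h2 := density_biUnion_le U fun u => {f ∈ A | f u = b}
  have h3 : ∑ u ∈ U, density {f ∈ A | f u = b} ≤ ∑ _u ∈ U, ε k l :=
    Finset.sum_le_sum fun u hu => le_of_lt (by simpa using hU hu)
  rw [Finset.sum_const, nsmul_eq_mul, hUm] at h3
  rw [density_forall_eq, hUm] at h1
  have h4 : 1 / e ≤ (⌈1 / e⌉₊ : ℝ) := Nat.le_ceil _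
  have h5 : (m : ℝ) < 1 / e + 2 := by
    rw [hm]; push_cast; linarith [Nat.ceil_lt_add_one (one_div_pos.2 he).le]
  have h6 : 1 / (2 : ℝ) ^ m ≤ e / 2 := by
    have : (⌈1 / e⌉₊ : ℝ) ≤ 2 ^ ⌈1 / e⌉₊ := by exact_mod_cast Nat.lt_two_pow_self.le
    rw [hm, pow_succ, div_le_div_iff₀ (by positivity) (by norm_num)]
    have h7 : 1 ≤ e * 2 ^ ⌈1 / e⌉₊ := by
      have := (div_le_iff₀ he).1 (h4.trans this)
      linarith
    linarith
  have h7 : (m : ℝ) * ε k l < e / 2 := by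
    have hm0 : (0 : ℝ) < m := by rw [hm]; positivity
    calc (m : ℝ) * ε k l < m * e ^ 3 := by gcongr
      _ ≤ (1 / e + 2) * e ^ 3 := by gcongr
      _ = e * (e * (1 + 2 * e)) := by field_simp
      _ ≤ e * (1 / 2) := by gcongr; nlinarith
      _ = e / 2 := by ring
  linarith

theorem ncard_badSet_le (hε : IsEpsSeq ε) {k : ℕ} (A : Set (Fn n k)) :
    ((badSet ε A).ncard : ℝ) ≤ 1 / ε k 0 := by
  have h0 := hε.pos k
  rcases le_or_gt (nor ε A) 1 with h | h
  · have : badSet ε A = ∅ := by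
      ext u
      simp only [badSet, Set.mem_ofPred_eq, Set.mem_empty_iff_false, iff_false]
      rintro ⟨b, hb⟩
      omega
    rw [this]
    simp only [Set.ncard_empty, Nat.cast_zero]
    positivity
  obtain ⟨l, hl⟩ : ∃ l, nor ε A = l + 1 := ⟨nor ε A - 1, by omega⟩
  have hlk : l < k := by have := nor_le (ε := ε) A; omega
  have hA := le_density_of_le_nor hε (by omega) hl.ge
  have hsub : badSet ε A ⊆ {u | density {f ∈ A | f u = true} < ε k l} ∪
      {u | density {f ∈ A | f u = false} < ε k l} := by
    rintro u ⟨b, hb⟩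
    have : density {f ∈ A | f u = b} < ε k l := by
      by_contra! hcon
      have := le_nor hlk.le hcon
      omega
    cases b
    · exact Or.inr this
    · exact Or.inl this
  have h1 := (Set.ncard_le_ncard hsub).trans (Set.ncard_union_le _ _)
  have h2 := card_rare_lt hε (by omega) hlk hA true
  have h3 := card_rare_lt hε (by omega) hlk hA false
  have h4 : ((badSet ε A).ncard : ℝ) ≤ 2 * ⌈1 / ε k (l + 1)⌉₊ := by
    exact_mod_cast (show (badSet ε A).ncard ≤ 2 * ⌈1 / ε k (l + 1)⌉₊ by omega)
  have he := hε.pos' hlk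
  set e := ε k (l + 1)
  have h5 : (⌈1 / e⌉₊ : ℝ) < 1 / e + 1 := Nat.ceil_lt_add_one (one_div_pos.2 he).le
  have he4 : e ≤ 1 / 4 := (hε.le_top hlk).trans <| by
    rw [div_le_div_iff_of_pos_left one_pos (by positivity) (by norm_num)]
    calc (4 : ℝ) = 2 ^ 2 := by norm_num
      _ ≤ 2 ^ k := pow_le_pow_right₀ (by norm_num) (by omega)
  have hcube : ε k 0 ≤ e ^ 3 := (hε.mono (Nat.zero_le l) hlk.le).trans (hε.lt_cube k l hlk).le
  calc ((badSet ε A).ncard : ℝ) ≤ 2 * (1 / e + 1) := by linarith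
    _ = 2 * e ^ 2 * (1 + e) / e ^ 3 := by field_simp
    _ ≤ 1 / e ^ 3 := by gcongr; nlinarith
    _ ≤ 1 / ε k 0 := one_div_le_one_div_of_le h0 hcube

theorem card_node_le (hmono : StrictMono n) (k : ℕ) :
    Nat.card (Node n k) ≤ 2 ^ (n k * 2 ^ n k) := by
  rw [Nat.card_pi]
  calc ∏ j : Fin k, Nat.card (Fn n j) ≤ ∏ _j : Fin k, 2 ^ 2 ^ n k := by
        refine Finset.prod_le_prod' fun j _ => ?_
        have hc : Nat.card (Fn n j) = 2 ^ 2 ^ (n (j + 1) - n j) := by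
          simp [Nat.card_eq_fintype_card, Fn, Block]
        rw [hc]
        have h1 : n (j + 1) - n j ≤ n k := (Nat.sub_le _ _).trans (hmono.monotone j.2)
        exact Nat.pow_le_pow_right (by norm_num) (Nat.pow_le_pow_right (by norm_num) h1)
    _ = 2 ^ (k * 2 ^ n k) := by
        rw [Finset.prod_const, Finset.card_univ, Fintype.card_fin, ← pow_mul, mul_comm]
    _ ≤ 2 ^ (n k * 2 ^ n k) :=
        Nat.pow_le_pow_right (by norm_num) (Nat.mul_le_mul_right _ hmono.le_apply)

/-- The restriction of `x` to the block `[n_k, n_{k+1})`. -/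
def blockOf (n : ℕ → ℕ) (k : ℕ) (x : ℕ → Bool) : Block n k := fun i => x i

/-- The sequences of length `n_{k+1}` whose last block is bad for some node of `T` of length `k`. -/
def badSeqs (T : Cond ε n) (k : ℕ) : Set (Fin (n (k + 1)) → Bool) :=
  {y | ∃ t ∈ T.level k, (fun i => y ⟨i, i.2.2⟩ : Block n k) ∈ badSet ε (succs T.level t)}

theorem ncard_badSeqs_le (hε : IsEpsSeq ε) (hmono : StrictMono n) (T : Cond ε n) (k : ℕ) :
    (badSeqs T k).ncard ≤ badBound ε n k := by
  classical
  have := Fintype.ofFinite (Node n k)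
  refine Nat.le_floor ?_
  have hsub : badSeqs T k ⊆ ⋃ t : Node n k,
      {y | (fun i => y ⟨i, i.2.2⟩ : Block n k) ∈ badSet ε (succs T.level t)} := by
    rintro y ⟨t, _, hy⟩
    exact Set.mem_iUnion.2 ⟨t, hy⟩
  have hpiece : ∀ t : Node n k, ({y : Fin (n (k + 1)) → Bool | (fun i => y ⟨i, i.2.2⟩ : Block n k) ∈
      badSet ε (succs T.level t)}.ncard : ℝ) ≤ 2 ^ n k * (1 / ε k 0) := by
    intro t
    have hle := Set.ncard_le_ncard_of_injOn
      (s := {y : Fin (n (k + 1)) → Bool | (fun i => y ⟨i, i.2.2⟩ : Block n k) ∈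
        badSet ε (succs T.level t)})
      (t := (Set.univ : Set (Fin (n k) → Bool)) ×ˢ badSet ε (succs T.level t))
      (fun y => (fun i => y (Fin.castLE (hmono (Nat.lt_succ_self k)).le i),
        fun i => y ⟨i, i.2.2⟩))
      (fun y hy => ⟨trivial, hy⟩)
      (by
        intro y _ y' _ h
        funext i
        rcases lt_or_ge (i : ℕ) (n k) with hi | hi
        · exact congrFun (congrArg Prod.fst h) ⟨i, hi⟩
        · exact congrFun (congrArg Prod.snd h) ⟨i, hi, i.2⟩)
    rw [Set.ncard_prod, Set.ncard_univ, Nat.card_eq_fintype_card, Fintype.card_fun,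
      Fintype.card_bool, Fintype.card_fin] at hle
    calc _ ≤ (2 : ℝ) ^ n k * (badSet ε (succs T.level t)).ncard := by exact_mod_cast hle
      _ ≤ _ := by gcongr; exact ncard_badSet_le hε _
  have h1 : (badSeqs T k).ncard ≤ ∑ t : Node n k, {y : Fin (n (k + 1)) → Bool |
      (fun i => y ⟨i, i.2.2⟩ : Block n k) ∈ badSet ε (succs T.level t)}.ncard :=
    (Set.ncard_le_ncard hsub).trans (Set.ncard_iUnion_le_of_fintype _)
  have h0 := hε.pos k
  calc ((badSeqs T k).ncard : ℝ) ≤ ∑ t : Node n k, ({y : Fin (n (k + 1)) → Bool |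
      (fun i => y ⟨i, i.2.2⟩ : Block n k) ∈ badSet ε (succs T.level t)}.ncard : ℝ) := by
        exact_mod_cast h1
    _ ≤ ∑ _t : Node n k, 2 ^ n k * (1 / ε k 0) := Finset.sum_le_sum fun t _ => hpiece t
    _ = Nat.card (Node n k) * (2 ^ n k * (1 / ε k 0)) := by
        rw [Finset.sum_const, nsmul_eq_mul, Finset.card_univ, Nat.card_eq_fintype_card]
    _ ≤ 2 ^ (n k * 2 ^ n k) * (2 ^ n k * (1 / ε k 0)) := by
        gcongr
        exact_mod_cast card_node_le hmono k
    _ = 2 ^ n k * (2 ^ (n k * 2 ^ n k) / ε k 0) := by ring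

/-- The intervals `[L_k, L_{k+1})`, where `L_k = ⌊(k+1) 2^{n_k} 2^{n_k 2^{n_k}} / ε^k_0⌋`, are long
enough for enumerations of the bad sequences of length `n_{k+2}`, and `g ≤ n_{k+2}` on them.  So some
`x ∈ X` has only finitely many bad initial segments, as `g` witnesses that `X` does not have strong
measure zero. -/
theorem exists_eventually_not_mem (hg : StrictMono g) (hε : IsEpsSeq ε) (hn : IsBlockSeq g ε n)
    {X : Set (ℕ → Bool)} (hX : WitnessesNotSMZ g X) (B : (k : ℕ) → Set (Fin (n (k + 1)) → Bool))
    (hB : ∀ k, (B k).ncard ≤ badBound ε n k) :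
    ∃ x ∈ X, ∀ᶠ k in atTop, (fun i : Fin (n (k + 1)) => x i) ∉ B k := by
  set L : ℕ → ℕ := fun k => ⌊((k : ℝ) + 1) * 2 ^ n k * (2 ^ (n k * 2 ^ n k) / ε k 0)⌋₊ with hL
  have hLn : ∀ k, L k ≤ n (k + 1) := IsBlockSeq.floor_le hg hn
  have hb : ∀ k, 2 ^ n k ≤ badBound ε n k := fun k => by
    refine Nat.le_floor ?_
    push_cast
    have h1 := IsBlockSeq.inv_le hε k
    have h2 : (1 : ℝ) ≤ 2 ^ (n k * 2 ^ n k) := one_le_pow₀ (by norm_num)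
    have h3 := hε.pos k
    refine le_mul_of_one_le_right (by positivity) ?_
    exact h1.trans (by gcongr)
  have hstep : ∀ k, L k + badBound ε n (k + 1) ≤ L (k + 1) := fun k => by
    have h1 : L k ≤ badBound ε n (k + 1) :=
      (hLn k).trans (Nat.lt_two_pow_self.le.trans (hb (k + 1)))
    have h2 : 2 * badBound ε n (k + 1) ≤ L (k + 1) := by
      have h3 := hε.pos (k + 1)
      refine Nat.le_floor ?_
      push_cast
      rw [mul_assoc]
      refine mul_le_mul (by linarith [(Nat.cast_nonneg k : (0 : ℝ) ≤ k)])
        (Nat.floor_le (by positivity)) (by positivity) (by positivity)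
    omega
  have hLmono : StrictMono L := strictMono_nat_of_lt_succ fun k => by
    have := hstep k
    have := (Nat.two_pow_pos (n (k + 1))).trans_le (hb (k + 1))
    omega
  have henum : ∀ k, ∃ e : ℕ → ℕ → Bool, ∀ y ∈ B k, ∃ j < badBound ε n k,
      ∀ i : Fin (n (k + 1)), e j i = y i := by
    intro k
    set l := (Set.toFinite (B k)).toFinset.toList with hl
    refine ⟨fun j i => if h : j < l.length ∧ i < n (k + 1) then l[j] ⟨i, h.2⟩ else false,
      fun y hy => ?_⟩
    have hyl : y ∈ l := by simpa [hl] using hy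
    obtain ⟨j, hj, rfl⟩ := List.getElem_of_mem hyl
    refine ⟨j, hj.trans_le ?_, fun i => by simp [hj]⟩
    rw [hl, Finset.length_toList, ← Set.ncard_eq_toFinset_card]
    exact hB k
  choose e he using henum
  by_contra! hcon
  have hfind : ∀ m, ∃ k, m < L (k + 1) := fun m => ⟨m, hLmono.le_apply⟩
  refine hX ⟨fun m i => e (Nat.find (hfind m) + 1) (m - L (Nat.find (hfind m))) i, fun x hx => ?_⟩
  refine frequently_atTop.2 fun m₀ => ?_
  obtain ⟨k, hk, hbad⟩ := frequently_atTop.1 (hcon x hx) (m₀ + 1)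
  obtain ⟨k, rfl⟩ : ∃ k', k = k' + 1 := ⟨k - 1, by omega⟩
  obtain ⟨j, hj, hej⟩ := he (k + 1) _ hbad
  have hm : L k + j < L (k + 1) := by have := hstep k; omega
  have hfindk : Nat.find (hfind (L k + j)) = k := by
    refine le_antisymm (Nat.find_min' _ hm) ?_
    by_contra! hlt
    have h1 := Nat.find_spec (hfind (L k + j))
    have h2 := hLmono.monotone (Nat.succ_le_of_lt hlt)
    simp only [Nat.succ_eq_add_one] at h2
    omega
  refine ⟨L k + j, ?_, ?_⟩
  · have : k ≤ L k := hLmono.le_apply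
    omega
  · funext i
    have hgn : g (L k + j) ≤ n (k + 1 + 1) :=
      (hg.monotone hm.le).trans (hn.large (k + 1))
    have := hej ⟨i, i.2.trans_le hgn⟩
    simp only [hfindk, Nat.add_sub_cancel_left]
    exact this.symm

end PgForcing

/-! ### The generic map -/

namespace Forcing

variable {P : Type} [Preorder P]

theorem ex_imp {I : Type} {φ ψ : I → Sentence P} {p : P} (h : ∀ q ≤ p, ∀ i, φ i q → ψ i q)
    (hφ : ex φ p) : ex ψ p := fun q hq =>
  let ⟨r, hr, i, hi⟩ := hφ q hq
  ⟨r, hr, i, h r (hr.trans hq) i hi⟩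

theorem SetName.mem_of_mem {x : RealName P} {A : SetName P} {p : P} (h : (x, p) ∈ A) {q : P}
    (hq : q ≤ p) : SetName.mem x A q :=
  fun r hr => ⟨r, le_rfl, x, p, h, hr.trans hq, RealName.eq_refl x r⟩

theorem SetName.mem_univ (x : RealName P) (p : P) : SetName.mem x (SetName.univ P) p :=
  SetName.mem_of_mem (A := SetName.univ P) (Set.mem_univ (x, p)) le_rfl

theorem mem_rationals_check {q : ℕ → Bool} {m : ℕ} (hq : ∀ k, m ≤ k → q k = false) (p : P) :
    SetName.mem (RealName.check P q) (rationals P) p := by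
  refine SetName.mem_of_mem (p := p) ?_ le_rfl
  intro r _
  refine ⟨r, le_rfl, m, fun k s _ hk => ?_⟩
  have := RealName.bit_check q k s
  rwa [hq k hk] at this

end Forcing

namespace PgForcing

open Forcing

variable {ε : ℕ → ℕ → ℝ} {n : ℕ → ℕ} {g : ℕ → ℕ}

open Cond

theorem genericFnEq_iff {k : ℕ} {f : Fn n k} {T : Cond ε n} :
    genericFnEq k f T ↔ ∀ s ∈ T.level (k + 1), s (Fin.last k) = f := by
  constructor
  · intro h s hs
    obtain ⟨R, hR, t, ht, htf⟩ := h (T.below s hs) (below_le hs)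
    have htR : t ∈ R.level (k + 1) := ht R R le_rfl fun Q hQ => ⟨Q, le_rfl, R, rfl, hQ⟩
    have : t = s := eq_of_mem_below (hR _ htR)
    exact this ▸ htf
  · intro h R hR
    obtain ⟨s, hs⟩ := R.level_nonempty (k + 1)
    refine ⟨R.below s hs, below_le hs, s, fun Q U hU hQ => ?_, h s (hR _ hs)⟩
    obtain ⟨W, hW, Q', hQ', hWQ⟩ := hQ U le_rfl
    obtain rfl : Q = Q' := hQ'
    obtain ⟨t, ht⟩ := W.level_nonempty (k + 1)
    have : t = s := eq_of_mem_below (hU _ (hW _ ht))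
    exact this ▸ hWQ _ ht

theorem blockEq_check_iff {x : ℕ → Bool} {k : ℕ} {u : Block n k} {T : Cond ε n} :
    blockEq (RealName.check _ x) k u T ↔ u = blockOf n k x := by
  constructor
  · intro h
    funext i
    exact RealName.bit_unique (h i) (RealName.bit_check x i T)
  · rintro rfl i
    exact RealName.bit_check x i T

theorem mem_genericMap {x : RealName (Cond ε n)} {k : ℕ} {T : Cond ε n} :
    SubName.mem k (genericMap x) T ↔ (ex fun u : Block n k => ex fun f : Fn n k =>
      and (blockEq x k u) (and (genericFnEq k f) (const (f u = true)))) T :=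
  RealName.mem_ofSentence (φ := fun k => ex fun u : Block n k => ex fun f : Fn n k =>
      and (blockEq x k u) (and (genericFnEq k f) (const (f u = true)))) (.ex _)

theorem mem_genericMap_check {x : ℕ → Bool} {k : ℕ} {T : Cond ε n} :
    SubName.mem k (genericMap (RealName.check _ x)) T ↔
      ∀ s ∈ T.level (k + 1), s (Fin.last k) (blockOf n k x) = true := by
  rw [mem_genericMap]
  constructor
  · intro h s hs
    obtain ⟨R, hR, u, hu⟩ := h (T.below s hs) (below_le hs)
    obtain ⟨Q, hQ, f, hxu, hf, hfu⟩ := hu R le_rfl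
    obtain ⟨t, ht⟩ := Q.level_nonempty (k + 1)
    have hts : t = s := eq_of_mem_below (hR _ (hQ _ ht))
    rw [← hts, genericFnEq_iff.1 hf t ht, ← blockEq_check_iff.1 hxu]
    exact hfu
  · intro h R hR
    refine ⟨R, le_rfl, blockOf n k x, fun Q hQ => ?_⟩
    obtain ⟨s, hs⟩ := Q.level_nonempty (k + 1)
    refine ⟨Q.below s hs, below_le hs, s (Fin.last k), blockEq_check_iff.2 rfl,
      genericFnEq_iff.2 fun t ht => ?_, h s (hR _ (hQ _ hs))⟩
    rw [eq_of_mem_below ht]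

theorem bit_genericMap_check {x : ℕ → Bool} {k : ℕ} {b : Bool} {T : Cond ε n}
    (h : ∀ s ∈ T.level (k + 1), s (Fin.last k) (blockOf n k x) = b) :
    RealName.bit (genericMap (RealName.check _ x)) k b T := by
  cases b
  · refine RealName.bit_false.2 fun R hR hmem => ?_
    obtain ⟨s, hs⟩ := R.level_nonempty (k + 1)
    exact Bool.false_ne_true ((h s (hR _ hs)).symm.trans (mem_genericMap_check.1 hmem s hs))
  · exact RealName.bit_true.2 (mem_genericMap_check.2 h)

/-- The first `m` bits of `F_G(x)` depend on the first `n_m` bits of `x` only. -/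
theorem forced_isContinuous_genericMap (hmono : StrictMono n) :
    Forced (P := Cond ε n) (isContinuous genericMap) := by
  intro T x m R hR
  refine ⟨R, le_rfl, n m, fun y Q _ hag i => ?_⟩
  have key : ∀ x y : RealName (Cond ε n), RealName.agree (n m) x y Q →
      ∀ U ≤ Q, SubName.mem (i : ℕ) (genericMap x) U → SubName.mem (i : ℕ) (genericMap y) U := by
    intro x y hag U hU hmem
    rw [mem_genericMap] at hmem ⊢
    refine ex_imp (fun V hV u => ex_imp fun W hW f => And.imp_left fun hu j => ?_) hmem
    have hj : (j : ℕ) < n m := j.2.2.trans_le (hmono.monotone i.2)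
    refine RealName.bit_of_iff ?_ (hu j)
    exact ((SubName.mem_isRegular _ x).iff (SubName.mem_isRegular _ y)).mono
      (hW.trans (hV.trans hU)) (hag ⟨j, hj⟩)
  exact ⟨key x y hag, key y x fun j => ⟨(hag j).2, (hag j).1⟩⟩

theorem isDecision_bit (z : RealName (Cond ε n)) (k : ℕ) : IsDecision (RealName.bit z k) where
  regular := RealName.bit_isRegular z k
  dense := RealName.exists_bit z k
  unique := RealName.bit_unique

/-- For every name `z` of a real, the conditions forcing `F_G(x)` to agree with `z` from some point on,
for some `x ∈ X`, are dense. -/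
theorem exists_eventually_bit_eq (hg : StrictMono g) (hε : IsEpsSeq ε) (hn : IsBlockSeq g ε n)
    {X : Set (ℕ → Bool)} (hX : WitnessesNotSMZ g X) (z : RealName (Cond ε n)) (T₀ : Cond ε n) :
    ∃ T ≤ T₀, ∃ x ∈ X, ∃ m, ∀ k, m ≤ k → ∀ R ≤ T, ∀ b, RealName.bit z k b R →
      RealName.bit (genericMap (RealName.check _ x)) k b R := by
  obtain ⟨T, hT, m₀, c, hc⟩ := exists_early_reading hg hε hn (isDecision_bit z) T₀
  obtain ⟨x, hx, hbad⟩ := exists_eventually_not_mem hg hε hn hX (badSeqs T)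
    (ncard_badSeqs_le hε hn.strictMono T)
  obtain ⟨m₁, hm₁⟩ := eventually_atTop.1 hbad
  obtain ⟨m₂, hm₂⟩ := T.exists_normGe 2
  obtain ⟨m, h0, h1, h2⟩ : ∃ m, m₀ ≤ m ∧ m₁ ≤ m ∧ m₂ ≤ m :=
    ⟨m₀ + m₁ + m₂, by omega, by omega, by omega⟩
  set S : (k : ℕ) → Node n k → Set (Fn n k) := fun k t => {f ∈ succs T.level t | m ≤ k →
    f (blockOf n k x) = c k t} with hS
  have hmem : ∀ k, ∀ t ∈ genLevel S k, t ∈ T.level k := by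
    intro k t ht
    cases k with
    | zero =>
      obtain ⟨u, hu⟩ := T.level_nonempty 0
      rwa [Subsingleton.elim t u]
    | succ k =>
      have := ht.2.1
      rwa [succs, Set.mem_ofPred_eq, Node.init_append_last] at this
  have hhigh : ∀ k, m ≤ k → ∀ t ∈ genLevel S k, nor ε (succs T.level t) ≤ nor ε (S k t) + 1 := by
    intro k hk t ht
    have hSk : S k t = {f ∈ succs T.level t | f (blockOf n k x) = c k t} := by
      ext f
      simp only [hS, hk, true_imp_iff]
    rw [hSk]
    by_contra! hcon
    exact hm₁ k (h1.trans hk) ⟨t, hmem k t ht, c k t, hcon⟩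
  obtain ⟨U, hU⟩ : ∃ U : Cond ε n, U.level = genLevel S := by
    refine exists_of_succs hg hε hn S (fun k t ht => ?_) fun M => ?_
    · rcases lt_or_ge k m with hk | hk
      · obtain ⟨f, hf⟩ := succs_nonempty (hmem k t ht)
        exact ⟨f, hf, fun h => absurd h (not_le.2 hk)⟩
      · have h3 := hhigh k hk t ht
        have h4 := hm₂ k (h2.trans hk) t (hmem k t ht)
        exact nonempty_of_one_le_nor hε (by omega)
    · filter_upwards [T.norm_tendsto (M + 1), eventually_ge_atTop m] with k hM hk t ht
      have h3 := hhigh k hk t ht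
      have h4 := hM t (hmem k t ht)
      omega
  have hUT : U ≤ T := fun k t ht => hmem k t (hU ▸ ht)
  refine ⟨U, hUT.trans hT, x, hx, m, fun k hk R hR b hb => bit_genericMap_check fun s hs => ?_⟩
  have hs' : s ∈ genLevel S (k + 1) := hU ▸ hR _ hs
  have hinit := mem_init hs
  have hcR := (RealName.bit_isRegular z k _).mono (below_mono (hR.trans hUT) hinit)
    (hc k (h0.trans hk) s.init ((hR.trans hUT) _ hinit))
  have hbR := (RealName.bit_isRegular z k b).mono (below_le hinit) hb
  rw [RealName.bit_unique hbR hcR]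
  exact hs'.2.2 hk

/-- For every name `z` of a real, the conditions forcing `z = F_q(x)` for some `x ∈ X` and some ground
model rational `q` are dense. -/
theorem exists_eq_genericTranslate (hg : StrictMono g) (hε : IsEpsSeq ε) (hn : IsBlockSeq g ε n)
    {X : Set (ℕ → Bool)} (hX : WitnessesNotSMZ g X) (z : RealName (Cond ε n)) (T₀ : Cond ε n) :
    ∃ T ≤ T₀, ∃ x ∈ X, ∃ q : ℕ → Bool, (∃ m, ∀ k, m ≤ k → q k = false) ∧
      RealName.eq z (genericTranslate (RealName.check _ q) (RealName.check _ x)) T := by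
  obtain ⟨T₁, hT₁, x, hx, m, hm⟩ := exists_eventually_bit_eq hg hε hn hX z T₀
  obtain ⟨T₂, hT₂, b, hb⟩ := RealName.exists_bits z m T₁
  obtain ⟨T, hT, c, hc⟩ := RealName.exists_bits (genericMap (RealName.check _ x)) m T₂
  refine ⟨T, hT.trans (hT₂.trans hT₁), x, hx, fun k => if k < m then c k ^^ b k else false,
    ⟨m, fun k hk => if_neg (not_lt.2 hk)⟩, fun k => RealName.iff_of_bit fun R hR a ha => ?_⟩
  have hq := RealName.bit_check (fun k => if k < m then c k ^^ b k else false) k R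
  rcases lt_or_ge k m with hk | hk
  · have h1 := (RealName.bit_isRegular z k _).mono (hR.trans hT) (hb k hk)
    have h2 := (RealName.bit_isRegular _ k _).mono hR (hc k hk)
    have h3 := RealName.bit_add h2 hq
    rw [if_pos hk, ← Bool.xor_assoc, Bool.xor_self, Bool.false_xor] at h3
    rw [RealName.bit_unique ha h1]
    exact h3
  · have h2 := hm k hk R (hR.trans (hT.trans hT₂)) a ha
    have h3 := RealName.bit_add h2 hq
    rw [if_neg (not_lt.2 hk), Bool.xor_false] at h3
    exact h3

theorem mem_image_check {X : Set (ℕ → Bool)} {x : ℕ → Bool} (hx : x ∈ X)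
    (F : RealName (Cond ε n) → RealName (Cond ε n)) (T : Cond ε n) :
    (F (RealName.check _ x), T) ∈ SetName.image F (SetName.check _ X) :=
  ⟨RealName.check _ x, ⟨x, hx, rfl⟩, rfl⟩

theorem forced_image_add_rationals_eq_univ (hg : StrictMono g) (hε : IsEpsSeq ε)
    (hn : IsBlockSeq g ε n) {X : Set (ℕ → Bool)} (hX : WitnessesNotSMZ g X) :
    Forced (P := Cond ε n) (SetName.eq
      (SetName.add (SetName.image genericMap (SetName.check _ X)) (rationals _))
      (SetName.univ _)) := by
  refine fun T => ⟨fun z R _ _ => SetName.mem_univ z R, fun z R hR _ => ?_⟩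
  refine SetName.mem_of_mem (p := R) ?_ le_rfl
  intro Q hQ
  obtain ⟨U, hU, x, hx, q, ⟨m, hq⟩, heq⟩ := exists_eq_genericTranslate hg hε hn hX z Q
  refine ⟨U, hU, genericMap (RealName.check _ x), fun V hV => ⟨V, le_rfl, RealName.check _ q,
    ?_, mem_rationals_check hq V, (RealName.eq_isRegular _ _).mono hV heq⟩⟩
  exact SetName.mem_of_mem (mem_image_check hx genericMap V) le_rfl

/-- If all `F_q''(X)`, for the countably many ground model rationals `q`, were in a σ-ideal, so would
be their union, which is `2^ω`. -/
theorem forced_exists_image_not_mem (hg : StrictMono g) (hε : IsEpsSeq ε)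
    (hn : IsBlockSeq g ε n) {X : Set (ℕ → Bool)} (hX : WitnessesNotSMZ g X) :
    Forced (P := Cond ε n) (all fun J : FamName (Cond ε n) => imp (FamName.isSigmaIdeal J)
      (ex fun q : RealName (Cond ε n) => and (SetName.mem q (rationals _))
        (neg (FamName.mem (SetName.image (genericTranslate q) (SetName.check _ X)) J)))) := by
  rintro T₀ J T - hJ R hR
  by_contra! hcon
  have hall : ∀ q : ℕ → Bool, (∃ m, ∀ k, m ≤ k → q k = false) →
      FamName.mem (SetName.image (genericTranslate (RealName.check _ q)) (SetName.check _ X)) J R := by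
    rintro q ⟨m, hm⟩
    refine (FamName.mem_isRegular _ _).of_dense fun Q hQ => ?_
    by_contra! hQ'
    exact hcon Q hQ (RealName.check _ q) ⟨mem_rationals_check hm Q, hQ'⟩
  -- The rationals are enumerated by their finite supports.
  obtain ⟨e, he⟩ := exists_surjective_nat (Finset ℕ)
  let q : ℕ → ℕ → Bool := fun i k => decide (k ∈ e i)
  have hq : ∀ i, ∃ m, ∀ k, m ≤ k → q i k = false := fun i => by
    obtain ⟨m, hm⟩ := (e i).bddAbove
    refine ⟨m + 1, fun k hk => decide_eq_false fun hki => ?_⟩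
    have : k ≤ m := hm hki
    omega
  obtain ⟨-, hsub, hunion, hproper⟩ := hJ
  have h1 := hunion
    (fun i => SetName.image (genericTranslate (RealName.check _ (q i))) (SetName.check _ X))
    R hR fun i => hall (q i) (hq i)
  refine hproper R hR (hsub _ _ R hR ?_ R le_rfl h1)
  intro z Q _ _ V _
  obtain ⟨W, hW, x, hx, r, ⟨m, hr⟩, heq⟩ := exists_eq_genericTranslate hg hε hn hX z V
  obtain ⟨i, hi⟩ := he ((Finset.range m).filter fun k => r k = true)
  have hri : r = q i := by
    funext k
    by_cases hk : k < m
    · simp [q, hi, hk]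
    · simp [q, hi, hk, hr k (not_lt.1 hk)]
  subst hri
  exact ⟨W, hW, _, W, Set.mem_iUnion.2 ⟨i, mem_image_check hx _ W⟩, le_rfl, heq⟩

end PgForcing

theorem mainTheorem5
    (g : ℕ → ℕ) (hg : StrictMono g)
    (ε : ℕ → ℕ → ℝ) (hε : PgForcing.IsEpsSeq ε)
    (n : ℕ → ℕ) (hn : PgForcing.IsBlockSeq g ε n)
    (X : Set (ℕ → Bool)) (hX : WitnessesNotSMZ g X) :
    Forcing.Forced (P := PgForcing.Cond ε n)
        (Forcing.isContinuous PgForcing.genericMap) ∧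
    Forcing.Forced (P := PgForcing.Cond ε n)
        (Forcing.SetName.eq
          (Forcing.SetName.add
            (Forcing.SetName.image PgForcing.genericMap (Forcing.SetName.check _ X))
            (Forcing.rationals _))
          (Forcing.SetName.univ _)) ∧
    Forcing.Forced (P := PgForcing.Cond ε n)
        (Forcing.all fun J : Forcing.FamName (PgForcing.Cond ε n) =>
          Forcing.imp (Forcing.FamName.isSigmaIdeal J)
            (Forcing.ex fun q : Forcing.RealName (PgForcing.Cond ε n) =>
              Forcing.and (Forcing.SetName.mem q (Forcing.rationals _))
                (Forcing.neg (Forcing.FamName.mem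
                  (Forcing.SetName.image (PgForcing.genericTranslate q)
                    (Forcing.SetName.check _ X)) J)))) :=
  ⟨PgForcing.forced_isContinuous_genericMap hn.strictMono,
    PgForcing.forced_image_add_rationals_eq_univ hg hε hn hX,
    PgForcing.forced_exists_image_not_mem hg hε hn hX⟩
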